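/- **Theorem (well-posedness of the adjoint $hp$-HDG formulation, one-field system).** Let $d\ge 1$, let $\Omega\subset\mathbb R^d$ be open (e.g. a Lipschitz polytope), and let $G,A_1,\dots,A_d:\Omega\to\mathbb R^{m\times m}$ satisfy * (A.1) $G\in[L^\infty(\Omega)]^{m,m}$; * (A.2) $A_k\in[L^\infty(\Omega)]^{m,m}$ for all $k$ and $\sum_{k}\partial_kA_k\in[L^\infty(\Omega)]^{m,m}$ (distributional derivatives); * (A.3) $A_k=A_k^T$ a.e. in $\Omega$ for all $k$; * (A.4) there is $\mu_0>0$ with $G+G^T+\sum_k\partial_kA_k\ge 2\mu_0 I$ a.e. in $\Omega$, where $B\ge C$ means that $v^T(B-C)v\ge 0$ for all $v\in\mathbb R^m$. *Mesh.* Let $\mathcal T_h$ be a finite collection of pairwise disjoint open simplices $K\subset\Omega$ with $\bigcup_K\overline K=\overline\Omega$ (hanging nodes are allowed), and let the skeleton $\mathcal E_h$ be a finite collection of flat mortars $e$ with pairwise intersections of zero surface measure: interior mortars $e\subset\partial K^+\cap\partial K^-$ belonging to two elements, and boundary mortars $e\subset\partial K\cap\partial\Omega$ belonging to one element (the set of these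 is $\mathcal E_h^\partial$), such that each $\partial K$ is, up to a set of zero surface measure, the union of the mortars belonging to $K$. Let $p_K\in\mathbb N$ for $K\in\mathcal T_h$, and put $p_e=\max\{p_{K^+},p_{K^-}\}$ on interior mortars and $p_e=p_K$ on boundary mortars. Let $V_h$ be the space of $\mathbb R^m$-valued functions that on each $K$ are polynomials of degree at most $p_K$, and $\widehat V_h$ the space of $\mathbb R^m$-valued $L^2$ functions on the skeleton that on each mortar $e$ are polynomials of degree at most $p_e$. *Normal matrix and stabilization.* On $\partial K$ let $A=\sum_k n_kA_k$, with $n$ the unit outward normal of $K$, be the normal trace in $[L^\infty(\partial K)]^{m,m}$ (characterized by Green's formula $\int_{\partial K}A\varphi=\int_K\sum_k A_k\partial_k\varphi+(\sum_k\partial_kA_k)\varphi$ for all smooth $\varphi$), which is assumed to be continuous across the skeleton, i.e. on an interior mortar the matrices $A$ seen from $K^+$ and $K^-$ are opposite. With $A=R\Lambda R^{-1}$ put $|A|=R|\Lambda|R^{-1}$ and $T=|A|$. On the boundary mortars let $M\in L^\infty$ be a matrix field (for instance $M=T$). *Adjoint formulation.* Let $J:V_h\times\widehat V_h\to\mathbb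 R$ be an output functional having, at a given state $Z_h$, a linear first variation with components $\frac{\delta J[Z_h]}{\delta z_h}$ and $\frac{\delta J[Z_h]}{\delta\widehat z_h}$. The adjoint problem is: seek $(w_h,\widehat w_h)\in V_h\times\widehat V_h$ such that for all $(\delta z_h,\delta\widehat z_h)\in V_h\times\widehat V_h$ $$\sum_{k}\bigl(w_h,\partial_k(A_k\,\delta z_h)\bigr)_{\mathcal T_h}+\bigl(G^Tw_h,\delta z_h\bigr)_{\mathcal T_h}+\bigl\langle -A\widehat w_h+T(w_h-\widehat w_h),\delta z_h\bigr\rangle_{\partial\mathcal T_h}=-\frac{\delta J[Z_h]}{\delta z_h}(\delta z_h),$$ $$\bigl\langle [\![-A\widehat w_h+T(w_h-\widehat w_h)]\!],\delta\widehat z_h\bigr\rangle_{\mathcal E_h}=\bigl\langle \tfrac12(-A+M)^T\widehat w_h,\delta\widehat z_h\bigr\rangle_{\mathcal E_h^\partial}+\frac{\delta J[Z_h]}{\delta\widehat z_h}(\delta\widehat z_h).$$ Here $(\cdot,\cdot)_{\mathcal T_h}=\sum_K(\cdot,\cdot)_{L^2(K)}$, $\langle\cdot,\cdot\rangle_{\partial\mathcal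 T_h}$ is the sum over all $K$ and all mortars $e$ belonging to $K$ of the $L^2(e)$ inner products, $\langle\cdot,\cdot\rangle_{\mathcal E_h}$ and $\langle\cdot,\cdot\rangle_{\mathcal E_h^\partial}$ are the sums over all mortars and over the boundary mortars, and $[\![f]\!]$ is the sum of the values of $f$ from the elements to which the mortar belongs. **Claim.** If $M\ge0$ a.e. on the boundary mortars and $\mathrm{Null}(A)=\{0\}$ a.e. on every mortar, then the adjoint problem has exactly one solution $(w_h,\widehat w_h)\in V_h\times\widehat V_h$. -/

import Mathlib

open MeasureTheory Matrix
open scoped ContDiff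

noncomputable section

namespace HDG

/-- Euclidean `d`-space. -/
abbrev E (d : ℕ) := EuclideanSpace ℝ (Fin d)

/-- Real `m × m` matrices. -/
abbrev Mat (m : ℕ) := Matrix (Fin m) (Fin m) ℝ

/-- The surface measure: the `(d-1)`-dimensional Hausdorff measure, normalised so that it agrees
with Lebesgue measure on flat pieces of dimension `d - 1`. -/
def surf (d : ℕ) : Measure (E d) := Measure.euclideanHausdorffMeasure (d - 1)

/-- The partial derivative `∂ₖ φ`. -/
def pd {d : ℕ} (k : Fin d) (φ : E d → ℝ) (x : E d) : ℝ :=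
  fderiv ℝ φ x (EuclideanSpace.single k 1)

/-- A matrix field that belongs to `[L^∞(μ)]^{m,m}`. -/
def MatLinfty {d m : ℕ} (B : E d → Mat m) (μ : Measure (E d)) : Prop :=
  ∀ i j, MemLp (fun x => B x i j) ⊤ μ

/-- `B ≥ 0`: the quadratic form of the (not necessarily symmetric) matrix `B` is nonnegative. -/
def SemiPos {m : ℕ} (B : Mat m) : Prop := ∀ v : Fin m → ℝ, 0 ≤ v ⬝ᵥ (B *ᵥ v)

open Classical in
/-- `|B| = R |Λ| R⁻¹` for a symmetric matrix `B = R Λ R⁻¹` (and `0` if `B` is not symmetric). -/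
def absMat {m : ℕ} (B : Mat m) : Mat m :=
  if h : B.IsHermitian then
    (h.eigenvectorUnitary : Mat m) * Matrix.diagonal (fun i => |h.eigenvalues i|) *
      star (h.eigenvectorUnitary : Mat m)
  else 0

/-- `D` is the distributional derivative `∑ₖ ∂ₖ Aₖ` in `Ω`, entry by entry. -/
def IsWeakDiv {d m : ℕ} (Ω : Set (E d)) (A : Fin d → E d → Mat m) (D : E d → Mat m) : Prop :=
  ∀ φ : E d → ℝ, ContDiff ℝ ∞ φ → HasCompactSupport φ → tsupport φ ⊆ Ω → ∀ i j,
    ∫ x in Ω, ∑ k, A k x i j * pd k φ x = - ∫ x in Ω, D x i j * φ x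

/-- The data of a one-field Friedrichs' system `∑ₖ ∂ₖ (Aₖ z) + G z = f` in `Ω`, with full
coercivity; `D` stands for `∑ₖ ∂ₖ Aₖ`. -/
structure OneFieldFriedrichs {d m : ℕ} (Ω : Set (E d)) (A : Fin d → E d → Mat m)
    (D G : E d → Mat m) : Prop where
  G_bdd : MatLinfty G (volume.restrict Ω)
  A_bdd : ∀ k, MatLinfty (A k) (volume.restrict Ω)
  D_bdd : MatLinfty D (volume.restrict Ω)
  weakDiv : IsWeakDiv Ω A D
  symm : ∀ k, ∀ᵐ x ∂(volume.restrict Ω), A k x = (A k x)ᵀ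
  coercive : ∃ μ₀ : ℝ, 0 < μ₀ ∧ ∀ᵐ x ∂(volume.restrict Ω),
    SemiPos (G x + (G x)ᵀ + D x - (2 * μ₀) • (1 : Mat m))

/-- `N ∈ [L^∞(∂K)]^{m,m}` is the outward normal trace `∑ₖ nₖ Aₖ` of the field `(Aₖ)ₖ` on `∂K`.
For bounded fields with a bounded weak divergence `D = ∑ₖ ∂ₖ Aₖ` the individual `Aₖ` need not have
boundary values; the normal trace on a bounded Lipschitz domain `K` is the (unique) bounded function
on `∂K` given by Green's formula. If the `Aₖ` are smooth up to the boundary it is the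
pointwise `∑ₖ nₖ Aₖ`, where `n` is the unit outward normal. -/
structure IsNormalTrace {d m : ℕ} (K : Set (E d)) (A : Fin d → E d → Mat m) (D : E d → Mat m)
    (N : E d → Mat m) : Prop where
  bdd : MatLinfty N ((surf d).restrict (frontier K))
  green : ∀ φ : E d → ℝ, ContDiff ℝ ∞ φ → ∀ i j,
    ∫ x in frontier K, N x i j * φ x ∂(surf d) =
      ∫ x in K, ((∑ k, A k x i j * pd k φ x) + D x i j * φ x)

/-- The open simplex. -/
def openSimplex {d : ℕ} (s : Affine.Simplex ℝ (E d) d) : Set (E d) :=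
  interior (convexHull ℝ (Set.range s.points))

/-- The closed face of a simplex opposite to the vertex `a`. -/
def facet {d : ℕ} (s : Affine.Simplex ℝ (E d) d) (a : Fin (d + 1)) : Set (E d) :=
  convexHull ℝ (s.points '' {a}ᶜ)

/-- An affine simplicial, possibly nonconforming mesh of `Ω` with its skeleton of split-sided
mortars. The elements are indexed by `𝒯`, the mortars by `ℰ`. `sides e` is the set of elements
to which the mortar `e` belongs: two for an interior mortar (a flat piece of `∂K⁺ ∩ ∂K⁻`), one for
a boundary mortar (a flat piece of `∂K ∩ ∂Ω`). The boundary of each element is, up to null sets,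
the disjoint union of its mortars. -/
structure Mesh (d : ℕ) (Ω : Set (E d)) (𝒯 ℰ : Type*) where
  simplex : 𝒯 → Affine.Simplex ℝ (E d) d
  elem_subset : ∀ K, openSimplex (simplex K) ⊆ Ω
  elem_disjoint : Pairwise fun K K' => Disjoint (openSimplex (simplex K)) (openSimplex (simplex K'))
  elem_cover : ⋃ K, closure (openSimplex (simplex K)) = closure Ω
  mortar : ℰ → Set (E d)
  sides : ℰ → Finset 𝒯
  card_sides : ∀ e, (sides e).card = 1 ∨ (sides e).card = 2
  mortar_measurable : ∀ e, MeasurableSet (mortar e)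
  mortar_flat : ∀ e, ∀ K ∈ sides e, ∃ a, mortar e ⊆ facet (simplex K) a
  mortar_boundary : ∀ e, (sides e).card = 1 → mortar e ⊆ frontier Ω
  mortar_disjoint : Pairwise fun e e' => surf d (mortar e ∩ mortar e') = 0
  mortar_cover : ∀ K,
    surf d (frontier (openSimplex (simplex K)) \ ⋃ e, ⋃ (_ : K ∈ sides e), mortar e) = 0

namespace Mesh

variable {d : ℕ} {Ω : Set (E d)} {𝒯 ℰ : Type*}

/-- The open element `K`. -/
def elem (mesh : Mesh d Ω 𝒯 ℰ) (K : 𝒯) : Set (E d) := openSimplex (mesh.simplex K)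

/-- The surface measure on the mortar `e`. -/
def mMeas (mesh : Mesh d Ω 𝒯 ℰ) (e : ℰ) : Measure (E d) := (surf d).restrict (mesh.mortar e)

/-- The mortar degree: `max (p K⁺) (p K⁻)` on an interior mortar, `p K` on a boundary mortar. -/
def mortarDeg (mesh : Mesh d Ω 𝒯 ℰ) (p : 𝒯 → ℕ) (e : ℰ) : ℕ := (mesh.sides e).sup p

end Mesh

/-- Polynomials of total degree at most `p` in `d` variables. -/
abbrev Poly (d p : ℕ) := MvPolynomial.restrictTotalDegree (Fin d) ℝ p

/-- The elements of `L²(μ)` that are a.e. equal to a polynomial of degree at most `p`. -/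
def polyL2 {d : ℕ} (p : ℕ) (μ : Measure (E d)) : Submodule ℝ (Lp ℝ 2 μ) where
  carrier := {f | ∃ q ∈ Poly d p, f =ᵐ[μ] fun x : E d => MvPolynomial.eval (fun k => x k) q}
  zero_mem' := ⟨0, Submodule.zero_mem _, by
    filter_upwards [Lp.coeFn_zero ℝ 2 μ] with x hx
    exact hx.trans (by simp)⟩
  add_mem' := by
    rintro f g ⟨q, hq, hf⟩ ⟨r, hr, hg⟩
    refine ⟨q + r, Submodule.add_mem _ hq hr, ?_⟩
    filter_upwards [Lp.coeFn_add f g, hf, hg] with x hx h1 h2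
    exact hx.trans (by simp [h1, h2])
  smul_mem' := by
    rintro c f ⟨q, hq, hf⟩
    refine ⟨c • q, Submodule.smul_mem _ c hq, ?_⟩
    filter_upwards [Lp.coeFn_smul c f, hf] with x hx h1
    exact hx.trans (by simp [h1, MvPolynomial.smul_eval])

section Spaces

variable {d : ℕ} {Ω : Set (E d)} {𝒯 ℰ : Type*}

/-- The volume space: an `ℝ^m`-valued function that on each `K` is a polynomial of degree at most
`p K`. (`K` is a nonempty open set, so a polynomial is the same thing as its restriction
to `K`.) -/
abbrev VolSpace (d : ℕ) {𝒯 : Type*} (p : 𝒯 → ℕ) (m : ℕ) := ∀ K : 𝒯, Fin m → Poly d (p K)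

/-- The trace space: an `ℝ^m`-valued `L²` function on the skeleton that on each mortar `e` is a
polynomial of degree at most `mortarDeg p e`. -/
abbrev TraceSpace (mesh : Mesh d Ω 𝒯 ℰ) (p : 𝒯 → ℕ) (m : ℕ) :=
  ∀ e : ℰ, Fin m → polyL2 (mesh.mortarDeg p e) (mesh.mMeas e)

/-- The value at `x` of a vector of polynomials. -/
def polyVal {d p m : ℕ} (w : Fin m → Poly d p) (x : E d) : Fin m → ℝ :=
  fun i => MvPolynomial.eval (fun k => x k) (w i : MvPolynomial (Fin d) ℝ)

/-- The value at `x` of the `k`-th partial derivative of a vector of polynomials. -/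
def polyPd {d p m : ℕ} (k : Fin d) (w : Fin m → Poly d p) (x : E d) : Fin m → ℝ :=
  fun i => MvPolynomial.eval (fun l => x l) (MvPolynomial.pderiv k (w i : MvPolynomial (Fin d) ℝ))

/-- The value at `x` of a vector of trace functions on one mortar. -/
def traceVal {d p m : ℕ} {μ : Measure (E d)} (w : Fin m → polyL2 p μ) (x : E d) : Fin m → ℝ :=
  fun i => (w i : Lp ℝ 2 μ) x

/-- The adjoint numerical flux `-A ŵ + |A| (w - ŵ)` on the mortar `e`, seen from the element `K`;
`N K` is the normal matrix `A = ∑ₖ nₖ Aₖ` on `∂K`, and `T = |A|`. -/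
def adjFlux {m : ℕ} (mesh : Mesh d Ω 𝒯 ℰ) (p : 𝒯 → ℕ) (N : 𝒯 → E d → Mat m)
    (w : VolSpace d p m) (wh : TraceSpace mesh p m) (K : 𝒯) (e : ℰ) (x : E d) : Fin m → ℝ :=
  -(N K x *ᵥ traceVal (wh e) x) + absMat (N K x) *ᵥ (polyVal (w K) x - traceVal (wh e) x)

variable [Fintype 𝒯] [Fintype ℰ]

open Classical in
/-- `(w, ŵ)` solves the adjoint hybridized discontinuous Galerkin formulation whose data is the
first variation `dJ` of an output functional. In the local equation `∑ₖ ∂ₖ (Aₖ δz)` is written out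
as `(∑ₖ ∂ₖ Aₖ) δz + ∑ₖ Aₖ ∂ₖ δz`, with `D = ∑ₖ ∂ₖ Aₖ`. In the global equation the jump on a
mortar is the sum of the contributions of its sides. -/
structure IsAdjointSolution {m : ℕ} (mesh : Mesh d Ω 𝒯 ℰ) (p : 𝒯 → ℕ)
    (A : Fin d → E d → Mat m) (D G : E d → Mat m) (N : 𝒯 → E d → Mat m) (M : E d → Mat m)
    (dJ : VolSpace d p m × TraceSpace mesh p m →ₗ[ℝ] ℝ)
    (W : VolSpace d p m × TraceSpace mesh p m) : Prop where
  local_eq : ∀ δz : VolSpace d p m,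
    (∑ K, ∫ x in mesh.elem K,
        polyVal (W.1 K) x ⬝ᵥ
          (D x *ᵥ polyVal (δz K) x + ∑ k, A k x *ᵥ polyPd k (δz K) x))
      + (∑ K, ∫ x in mesh.elem K, ((G x)ᵀ *ᵥ polyVal (W.1 K) x) ⬝ᵥ polyVal (δz K) x)
      + (∑ K, ∑ e with K ∈ mesh.sides e,
          ∫ x, adjFlux mesh p N W.1 W.2 K e x ⬝ᵥ polyVal (δz K) x ∂(mesh.mMeas e))
      = - dJ (δz, 0)
  global_eq : ∀ δzh : TraceSpace mesh p m,
    (∑ e, ∫ x, (∑ K ∈ mesh.sides e, adjFlux mesh p N W.1 W.2 K e x) ⬝ᵥ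
        traceVal (δzh e) x ∂(mesh.mMeas e))
      = (∑ e with (mesh.sides e).card = 1, ∑ K ∈ mesh.sides e,
          ∫ x, ((1 / 2 : ℝ) • ((-(N K x) + M x)ᵀ *ᵥ traceVal (W.2 e) x)) ⬝ᵥ
            traceVal (δzh e) x ∂(mesh.mMeas e))
        + dJ (0, δzh)

end Spaces

end HDG

end

/-! Once bases are chosen the adjoint problem is a square linear system: subtracting the global
equation from the local one turns it into a single equation `(Φ₁ - Φ₂) W = -dJ`, where `Φ₁ - Φ₂`
maps the finite-dimensional space of pairs (w, ŵ) to its dual. Existence and uniqueness for every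
right-hand side therefore follow from injectivity, and injectivity from an energy argument with the
solution itself as test function.

On each element, Green's formula for the normal trace turns the volume terms into half the form of G
+ Gᵀ + D plus half the boundary form of A in w (`IsNormalTrace.local_energy`). Completing the square
on each side of each mortar (`flux_dotProduct_identity`) leaves the form of |A| + A/2 in w - ŵ and
half the form of A in ŵ. The latter cancels between the two sides of an interior mortar, because the
normal matrices are opposite; on a boundary mortar it combines with the boundary operator to half
the form of M, which is nonnegative (`mortar_nonneg`). The result is `energy_eq`, a sum of three
nonnegative parts.

If the energy vanishes, coercivity gives w = 0. Since |t| + t/2 ≥ |t|/2 and A is nonsingular, |A| +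
A/2 is positive definite almost everywhere, so w - ŵ = 0 on the skeleton and hence ŵ = 0.

Two points need care. The symmetry of A is not assumed but inherited: D is symmetric as the weak
divergence of symmetric fields, and the normal trace by Green's formula. And |A| has to be a bounded
measurable field, which is seen by approximating |t| by polynomials. -/

namespace HDG

/-! ### The absolute value of a symmetric matrix: definiteness, bounds and measurability -/

section AbsMat

variable {m : ℕ} {B : Mat m}

theorem absMat_of_isHermitian (h : B.IsHermitian) :
    absMat B = (h.eigenvectorUnitary : Mat m) * Matrix.diagonal (fun i => |h.eigenvalues i|) *
      star (h.eigenvectorUnitary : Mat m) := by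
  rw [absMat, dif_pos h]

theorem unitary_mul_diagonal_mul_star_apply (U : Mat m) (f : Fin m → ℝ) (i j : Fin m) :
    (U * Matrix.diagonal f * star U) i j = ∑ k, U i k * f k * U j k := by
  simp [Matrix.mul_apply, Matrix.diagonal_apply, Matrix.star_apply]

theorem eq_eigenvectorUnitary_mul_diagonal (h : B.IsHermitian) :
    B = (h.eigenvectorUnitary : Mat m) * Matrix.diagonal h.eigenvalues *
      star (h.eigenvectorUnitary : Mat m) := by
  conv_lhs => rw [h.spectral_theorem]
  rfl

/-- A polynomial of a symmetric matrix acts on the eigenvalues. -/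
theorem aeval_isHermitian (h : B.IsHermitian) (q : Polynomial ℝ) :
    Polynomial.aeval B q = (h.eigenvectorUnitary : Mat m) *
      Matrix.diagonal (fun i => q.eval (h.eigenvalues i)) *
      star (h.eigenvectorUnitary : Mat m) := by
  have hd : Polynomial.aeval (Matrix.diagonal h.eigenvalues) q =
      Matrix.diagonal (fun i => q.eval (h.eigenvalues i)) := by
    have h1 := Polynomial.aeval_algHom_apply (Matrix.diagonalAlgHom ℝ) h.eigenvalues q
    have h2 : Polynomial.aeval h.eigenvalues q = fun i => q.eval (h.eigenvalues i) := by
      funext i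
      simp [Polynomial.aeval_def, Polynomial.eval₂_eq_eval_map]
    rw [h2] at h1
    exact h1
  conv_lhs => rw [h.spectral_theorem]
  have h3 := Polynomial.aeval_algHom_apply
    (Unitary.conjStarAlgAut ℝ (Mat m) h.eigenvectorUnitary).toAlgEquiv.toAlgHom
    (Matrix.diagonal h.eigenvalues) q
  rw [hd] at h3
  exact h3

theorem abs_eigenvectorUnitary_le_one (h : B.IsHermitian) (i j : Fin m) :
    |(h.eigenvectorUnitary : Mat m) i j| ≤ 1 :=
  entry_norm_bound_of_unitary h.eigenvectorUnitary.2 i j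

/-- The eigenvalue is the Rayleigh quotient of a column of the orthogonal eigenvector matrix, whose
entries are at most 1 in modulus. -/
theorem abs_eigenvalues_le (h : B.IsHermitian) (k : Fin m) :
    |h.eigenvalues k| ≤ ∑ i, ∑ j, |B i j| := by
  have hU : star (h.eigenvectorUnitary : Mat m) * B * (h.eigenvectorUnitary : Mat m) =
      Matrix.diagonal h.eigenvalues := by
    have := h.conjStarAlgAut_star_eigenvectorUnitary
    rw [Unitary.conjStarAlgAut_star_apply] at this
    exact this
  have h1 : h.eigenvalues k = ∑ i, ∑ j, (h.eigenvectorUnitary : Mat m) i k * B i j *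
      (h.eigenvectorUnitary : Mat m) j k := by
    have := congrFun (congrFun hU k) k
    simp only [Matrix.mul_apply, Matrix.star_apply, Matrix.diagonal_apply_eq] at this
    simp only [star_trivial] at this
    rw [← this, Finset.sum_comm]
    simp only [Finset.sum_mul]
  rw [h1]
  refine (Finset.abs_sum_le_sum_abs _ _).trans (Finset.sum_le_sum fun i _ =>
    (Finset.abs_sum_le_sum_abs _ _).trans (Finset.sum_le_sum fun j _ => ?_))
  rw [abs_mul, abs_mul]
  have h2 := abs_eigenvectorUnitary_le_one h i k
  have h3 := abs_eigenvectorUnitary_le_one h j k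
  calc |(h.eigenvectorUnitary : Mat m) i k| * |B i j| * |(h.eigenvectorUnitary : Mat m) j k|
      ≤ 1 * |B i j| * 1 := by gcongr
    _ = |B i j| := by ring

theorem abs_absMat_le (h : B.IsHermitian) (i j : Fin m) :
    |absMat B i j| ≤ m * ∑ a, ∑ b, |B a b| := by
  rw [absMat_of_isHermitian h, unitary_mul_diagonal_mul_star_apply]
  refine (Finset.abs_sum_le_sum_abs _ _).trans ?_
  have : ∀ k ∈ (Finset.univ : Finset (Fin m)), |(h.eigenvectorUnitary : Mat m) i k *
      |h.eigenvalues k| * (h.eigenvectorUnitary : Mat m) j k| ≤ ∑ a, ∑ b, |B a b| := by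
    intro k _
    rw [abs_mul, abs_mul, abs_abs]
    have h2 := abs_eigenvectorUnitary_le_one h i k
    have h3 := abs_eigenvectorUnitary_le_one h j k
    calc _ ≤ 1 * (∑ a, ∑ b, |B a b|) * 1 := by
          gcongr
          exact abs_eigenvalues_le h k
      _ = _ := by ring
  refine (Finset.sum_le_card_nsmul _ _ _ this).trans (by simp)

theorem dotProduct_unitary_diagonal (U : Mat m) (f : Fin m → ℝ) (v : Fin m → ℝ) :
    v ⬝ᵥ ((U * Matrix.diagonal f * star U) *ᵥ v) = ∑ k, f k * ((star U *ᵥ v) k) ^ 2 := by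
  rw [← Matrix.mulVec_mulVec, ← Matrix.mulVec_mulVec, Matrix.dotProduct_mulVec]
  have : v ᵥ* U = star U *ᵥ v := by
    rw [← Matrix.mulVec_transpose]
    rfl
  rw [this]
  simp only [dotProduct, Matrix.mulVec_diagonal]
  exact Finset.sum_congr rfl fun k _ => by ring

theorem absMat_add_half (h : B.IsHermitian) :
    absMat B + (1 / 2 : ℝ) • B = (h.eigenvectorUnitary : Mat m) *
      Matrix.diagonal (fun i => |h.eigenvalues i| + (1 / 2) * h.eigenvalues i) *
      star (h.eigenvectorUnitary : Mat m) := by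
  ext i j
  rw [Matrix.add_apply, Matrix.smul_apply]
  conv_lhs =>
    rw [absMat_of_isHermitian h]
    enter [2, 2]
    rw [eq_eigenvectorUnitary_mul_diagonal h]
  simp only [unitary_mul_diagonal_mul_star_apply, smul_eq_mul, Finset.mul_sum,
    ← Finset.sum_add_distrib]
  exact Finset.sum_congr rfl fun k _ => by ring

theorem abs_add_half_nonneg (t : ℝ) : 0 ≤ |t| + (1 / 2) * t := by
  have := neg_abs_le t
  have := abs_nonneg t
  linarith

theorem semiPos_absMat_add_half (h : B.IsHermitian) : SemiPos (absMat B + (1 / 2 : ℝ) • B) := by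
  intro v
  rw [absMat_add_half h, dotProduct_unitary_diagonal]
  exact Finset.sum_nonneg fun k _ => mul_nonneg (abs_add_half_nonneg _) (sq_nonneg _)

/-- For a nonsingular symmetric matrix `B`, the form of `|B| + B / 2` is definite. -/
theorem eq_zero_of_absMat_add_half (h : B.IsHermitian) (hB : ∀ v : Fin m → ℝ, B *ᵥ v = 0 → v = 0)
    {v : Fin m → ℝ} (hv : v ⬝ᵥ ((absMat B + (1 / 2 : ℝ) • B) *ᵥ v) = 0) : v = 0 := by
  apply hB
  rw [absMat_add_half h, dotProduct_unitary_diagonal, Finset.sum_eq_zero_iff_of_nonneg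
    (fun k _ => mul_nonneg (abs_add_half_nonneg _) (sq_nonneg _))] at hv
  rw [eq_eigenvectorUnitary_mul_diagonal h, ← Matrix.mulVec_mulVec, ← Matrix.mulVec_mulVec]
  have : Matrix.diagonal h.eigenvalues *ᵥ (star (h.eigenvectorUnitary : Mat m) *ᵥ v) = 0 := by
    funext k
    rw [Matrix.mulVec_diagonal, Pi.zero_apply]
    -- Each eigencoordinate contributes zero: either the weight |λ| + λ/2 ≥ |λ|/2 vanishes, and then
    -- λ = 0, or the coordinate of v does. Both give λ times the coordinate equal to 0.
    rcases mul_eq_zero.1 (hv k (Finset.mem_univ k)) with h0 | h0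
    · have h1 := neg_abs_le (h.eigenvalues k)
      have h2 := abs_nonneg (h.eigenvalues k)
      have h3 : |h.eigenvalues k| = 0 := by linarith
      rw [abs_eq_zero.1 h3, zero_mul]
    · rw [pow_eq_zero_iff two_ne_zero] at h0
      rw [h0, mul_zero]
  rw [this, Matrix.mulVec_zero]

/-- `|t|` is a pointwise limit of polynomials. -/
theorem exists_polynomial_tendsto_abs : ∃ q : ℕ → Polynomial ℝ,
    ∀ t : ℝ, Filter.Tendsto (fun n => (q n).eval t) Filter.atTop (nhds |t|) := by
  -- Weierstrass on the growing intervals [-n, n] with tolerance 1/(n+1); every fixed t eventually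
  -- lies inside.
  have h : ∀ n : ℕ, ∃ p : Polynomial ℝ, ∀ x ∈ Set.Icc (-(n : ℝ)) n,
      |p.eval x - abs x| < 1 / ((n : ℝ) + 1) := fun n =>
    exists_polynomial_near_of_continuousOn _ _ (fun x => |x|) continuous_abs.continuousOn _
      Nat.one_div_pos_of_nat
  choose q hq using h
  refine ⟨q, fun t => ?_⟩
  rw [tendsto_iff_dist_tendsto_zero]
  refine squeeze_zero' (Filter.Eventually.of_forall fun _ => dist_nonneg) ?_
    tendsto_one_div_add_atTop_nhds_zero_nat
  filter_upwards [Filter.eventually_ge_atTop ⌈|t|⌉₊] with n hn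
  have : |t| ≤ n := (Nat.le_ceil _).trans (by exact_mod_cast hn)
  exact (hq n t (abs_le.1 this)).le

theorem tendsto_aeval_absMat {q : ℕ → Polynomial ℝ}
    (hq : ∀ t : ℝ, Filter.Tendsto (fun n => (q n).eval t) Filter.atTop (nhds |t|))
    (h : B.IsHermitian) (i j : Fin m) :
    Filter.Tendsto (fun n => Polynomial.aeval B (q n) i j) Filter.atTop (nhds (absMat B i j)) := by
  simp only [absMat_of_isHermitian h, aeval_isHermitian h, unitary_mul_diagonal_mul_star_apply]
  exact tendsto_finsetSum _ fun k _ => ((hq _).const_mul _).mul_const _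

variable {d : ℕ} {μ : Measure (E d)} {F : E d → Mat m}

theorem aestronglyMeasurable_pow_apply (hF : ∀ i j, AEStronglyMeasurable (fun x => F x i j) μ)
    (n : ℕ) : ∀ i j, AEStronglyMeasurable (fun x => (F x ^ n) i j) μ := by
  induction n with
  | zero => exact fun i j => by simpa using aestronglyMeasurable_const
  | succ n ih =>
    intro i j
    simp only [pow_succ, Matrix.mul_apply]
    exact Finset.aestronglyMeasurable_fun_sum _ fun k _ => (ih i k).mul (hF k j)

theorem aestronglyMeasurable_aeval_apply (hF : ∀ i j, AEStronglyMeasurable (fun x => F x i j) μ)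
    (q : Polynomial ℝ) (i j : Fin m) :
    AEStronglyMeasurable (fun x => Polynomial.aeval (F x) q i j) μ := by
  simp only [Polynomial.aeval_eq_sum_range, Matrix.sum_apply, Matrix.smul_apply]
  exact Finset.aestronglyMeasurable_fun_sum _ fun k _ =>
    (aestronglyMeasurable_pow_apply hF k i j).const_mul _

/-- The entries of |F| are a.e. limits of polynomials in the entries of F, so no measurable choice
of eigenvectors is needed. Boundedness is `abs_absMat_le`. -/
theorem MatLinfty.absMat (hF : MatLinfty F μ) (hs : ∀ᵐ x ∂μ, (F x).IsHermitian) :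
    MatLinfty (fun x => absMat (F x)) μ := by
  intro i j
  obtain ⟨q, hq⟩ := exists_polynomial_tendsto_abs
  have hmeas : AEStronglyMeasurable (fun x => HDG.absMat (F x) i j) μ :=
    aestronglyMeasurable_of_tendsto_ae Filter.atTop
      (fun n => aestronglyMeasurable_aeval_apply (fun i j => (hF i j).1) (q n) i j)
      (hs.mono fun x hx => tendsto_aeval_absMat hq hx i j)
  have hsum : MemLp (fun x => ∑ a, ∑ b, |F x a b|) ⊤ μ :=
    memLp_finsetSum _ fun a _ => memLp_finsetSum _ fun b _ => (hF a b).abs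
  refine hsum.of_le_mul (c := m) hmeas (hs.mono fun x hx => ?_)
  rw [Real.norm_eq_abs, Real.norm_eq_abs, abs_of_nonneg (a := ∑ a, ∑ b, |F x a b|) (Finset.sum_nonneg fun a _ => Finset.sum_nonneg fun b _ => abs_nonneg _)]
  exact abs_absMat_le hx i j

end AbsMat

/-! ### Simplices and the finite surface measure of their facets -/

section Simplex

variable {d : ℕ} (s : Affine.Simplex ℝ (E d) d)

theorem affineSpan_simplex : affineSpan ℝ (Set.range s.points) = ⊤ :=
  s.independent.affineSpan_eq_top_iff_card_eq_finrank_add_one.2 (by simp)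

/-- The affine basis of the vertices of a simplex of full dimension. -/
noncomputable def simplexBasis : AffineBasis (Fin (d + 1)) ℝ (E d) :=
  ⟨s.points, s.independent, affineSpan_simplex s⟩

theorem isOpen_openSimplex : IsOpen (openSimplex s) := isOpen_interior

theorem openSimplex_nonempty : (openSimplex s).Nonempty :=
  interior_convexHull_nonempty_iff_affineSpan_eq_top.2 (affineSpan_simplex s)

theorem isCompact_convexHull_points : IsCompact (convexHull ℝ (Set.range s.points)) :=
  (Set.finite_range _).isCompact_convexHull ℝ

theorem closure_openSimplex : closure (openSimplex s) = convexHull ℝ (Set.range s.points) := by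
  rw [openSimplex, (convex_convexHull ℝ _).closure_interior_eq_closure_of_nonempty_interior
    (openSimplex_nonempty s), (isCompact_convexHull_points s).isClosed.closure_eq]

theorem isCompact_closure_openSimplex : IsCompact (closure (openSimplex s)) := by
  rw [closure_openSimplex]
  exact isCompact_convexHull_points s

theorem isCompact_facet (a : Fin (d + 1)) : IsCompact (facet s a) :=
  ((Set.toFinite _).image _).isCompact_convexHull ℝ

/-- The barycentric coordinate of the vertex `a` vanishes on the opposite facet, but is positive in
the interior of the simplex. -/
theorem facet_subset_frontier (a : Fin (d + 1)) : facet s a ⊆ frontier (openSimplex s) := by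
  intro x hx
  rw [(isOpen_openSimplex s).frontier_eq]
  refine ⟨?_, fun hx' => ?_⟩
  · rw [closure_openSimplex]
    exact convexHull_mono (Set.image_subset_range _ _) hx
  · have h0 : (simplexBasis s).coord a x = 0 := by
      have hc : Convex ℝ {y | (simplexBasis s).coord a y = 0} :=
        (convex_singleton (0 : ℝ)).affine_preimage ((simplexBasis s).coord a)
      refine convexHull_min ?_ hc hx
      rintro _ ⟨b, hb, rfl⟩
      exact (simplexBasis s).coord_apply_ne (Ne.symm hb)
    have h1 : 0 < (simplexBasis s).coord a x := by
      have := (simplexBasis s).interior_convexHull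
      have h2 : x ∈ interior (convexHull ℝ (Set.range (simplexBasis s))) := hx'
      rw [this] at h2
      exact h2 a
    exact h1.ne' h0

/-- The facet lies in the image of the unit cube of dimension d - 1 under an affine, hence
Lipschitz, map; Hausdorff measure grows by at most a finite factor under such a map. -/
theorem surf_facet_lt_top (hd : 0 < d) (a : Fin (d + 1)) : surf d (facet s a) < ⊤ := by
  obtain ⟨n, rfl⟩ : ∃ n, d = n + 1 := ⟨d - 1, by omega⟩
  let q : Fin (n + 1) → E (n + 1) := fun i => s.points (a.succAbove i)
  let L : (Fin n → ℝ) →ₗ[ℝ] E (n + 1) := Fintype.linearCombination ℝ fun i => q i.succ - q 0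
  let f : (Fin n → ℝ) →ᵃ[ℝ] E (n + 1) := L.toAffineMap + AffineMap.const ℝ _ (q 0)
  -- The image of the cube is convex and contains the vertices of the facet: the origin goes to `q
  -- 0`, the unit vectors to the others.
  have hsub : facet s a ⊆ f '' Set.Icc 0 1 := by
    have hset : s.points '' {a}ᶜ = Set.range q := by
      rw [← Fin.range_succAbove, ← Set.range_comp]
      rfl
    rw [facet, hset]
    refine convexHull_min ?_ ((convex_Icc _ _).affine_image f)
    rintro _ ⟨i, rfl⟩
    refine Fin.cases ⟨0, by simp, by simp [f]⟩ (fun i => ?_) i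
    refine ⟨Pi.single i 1, ⟨Pi.single_nonneg.2 zero_le_one, fun j => ?_⟩, ?_⟩
    · rw [Pi.single_apply]
      split_ifs <;> simp
    · simp [f, L, Fintype.linearCombination_apply_single]
  have hlip : LipschitzWith (‖L.toContinuousLinearMap‖₊ + 0) f :=
    L.toContinuousLinearMap.lipschitz.add (LipschitzWith.const _)
  have hfin : Measure.hausdorffMeasure (n : ℝ) (f '' Set.Icc 0 1) < ⊤ := by
    refine (hlip.hausdorffMeasure_image_le (Nat.cast_nonneg n) _).trans_lt ?_
    refine ENNReal.mul_lt_top (by simp) ?_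
    have := hausdorffMeasure_pi_real (ι := Fin n)
    rw [Fintype.card_fin] at this
    rw [this]
    exact isCompact_Icc.measure_lt_top
  rw [surf, Measure.euclideanHausdorffMeasure_def, Measure.smul_apply, Nat.add_sub_cancel]
  refine ENNReal.mul_lt_top (by simp) ((measure_mono hsub).trans_lt hfin)

end Simplex

/-! ### Square-integrable vector fields and bounded matrix fields -/

section VecL2

variable {d m : ℕ} {μ ν : Measure (E d)}

/-- A vector field with square-integrable components. -/
def VecL2 (f : E d → Fin m → ℝ) (μ : Measure (E d)) : Prop :=
  ∀ i, MemLp (fun x => f x i) 2 μ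

theorem MatLinfty.mono_measure {B : E d → Mat m} (hB : MatLinfty B μ) (h : ν ≤ μ) :
    MatLinfty B ν :=
  fun i j => (hB i j).mono_measure h

theorem MatLinfty.transpose {B : E d → Mat m} (hB : MatLinfty B μ) :
    MatLinfty (fun x => (B x)ᵀ) μ :=
  fun i j => hB j i

theorem MatLinfty.add {B C : E d → Mat m} (hB : MatLinfty B μ) (hC : MatLinfty C μ) :
    MatLinfty (fun x => B x + C x) μ :=
  fun i j => (hB i j).add (hC i j)

theorem MatLinfty.neg {B : E d → Mat m} (hB : MatLinfty B μ) : MatLinfty (fun x => -B x) μ :=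
  fun i j => (hB i j).neg

theorem MatLinfty.smul {B : E d → Mat m} (hB : MatLinfty B μ) (c : ℝ) :
    MatLinfty (fun x => c • B x) μ :=
  fun i j => (hB i j).const_mul c

variable {f g : E d → Fin m → ℝ} {B : E d → Mat m}

theorem VecL2.add (hf : VecL2 f μ) (hg : VecL2 g μ) : VecL2 (fun x => f x + g x) μ :=
  fun i => (hf i).add (hg i)

theorem VecL2.sub (hf : VecL2 f μ) (hg : VecL2 g μ) : VecL2 (fun x => f x - g x) μ :=
  fun i => (hf i).sub (hg i)

theorem VecL2.smul (hf : VecL2 f μ) (c : ℝ) : VecL2 (fun x => c • f x) μ :=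
  fun i => (hf i).const_mul c

theorem VecL2.sum {ι : Type*} {s : Finset ι} {f : ι → E d → Fin m → ℝ}
    (hf : ∀ k ∈ s, VecL2 (f k) μ) : VecL2 (fun x => ∑ k ∈ s, f k x) μ := by
  intro i
  simp only [Finset.sum_apply]
  exact memLp_finsetSum _ fun k hk => hf k hk i

theorem VecL2.mulVec (hB : MatLinfty B μ) (hf : VecL2 f μ) : VecL2 (fun x => B x *ᵥ f x) μ := by
  intro i
  change MemLp (fun x => ∑ j, B x i j * f x j) 2 μ
  exact memLp_finsetSum _ fun j _ => (hf j).mul' (hB i j)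

theorem VecL2.integrable_dotProduct (hf : VecL2 f μ) (hg : VecL2 g μ) :
    Integrable (fun x => f x ⬝ᵥ g x) μ :=
  integrable_finsetSum _ fun i _ => (hf i).integrable_mul (hg i)

end VecL2

/-! ### Bilinear forms from fields that depend linearly on the unknown -/

section L2Field

variable {d m : ℕ} {X : Type*} [AddCommGroup X] [Module ℝ X] {μ : Measure (E d)}

/-- A map into the square-integrable vector fields that is linear up to null sets. -/
structure IsL2Field (μ : Measure (E d)) (F : X → E d → Fin m → ℝ) : Prop where
  vecL2 : ∀ W, VecL2 (F W) μ
  map_add : ∀ W W', ∀ᵐ x ∂μ, F (W + W') x = F W x + F W' x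
  map_smul : ∀ (c : ℝ) W, ∀ᵐ x ∂μ, F (c • W) x = c • F W x

namespace IsL2Field

variable {F H : X → E d → Fin m → ℝ}

theorem add (hF : IsL2Field μ F) (hH : IsL2Field μ H) :
    IsL2Field μ fun W x => F W x + H W x where
  vecL2 W := (hF.vecL2 W).add (hH.vecL2 W)
  map_add W W' := by
    filter_upwards [hF.map_add W W', hH.map_add W W'] with x h1 h2
    rw [h1, h2]
    abel
  map_smul c W := by
    filter_upwards [hF.map_smul c W, hH.map_smul c W] with x h1 h2
    rw [h1, h2, smul_add]

theorem smul (hF : IsL2Field μ F) (a : ℝ) : IsL2Field μ fun W x => a • F W x where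
  vecL2 W := (hF.vecL2 W).smul a
  map_add W W' := by
    filter_upwards [hF.map_add W W'] with x h1
    rw [h1, smul_add]
  map_smul c W := by
    filter_upwards [hF.map_smul c W] with x h1
    rw [h1, smul_comm]

theorem neg (hF : IsL2Field μ F) : IsL2Field μ fun W x => -F W x := by
  simpa using hF.smul (-1)

theorem sub (hF : IsL2Field μ F) (hH : IsL2Field μ H) :
    IsL2Field μ fun W x => F W x - H W x := by
  simpa [sub_eq_add_neg] using hF.add hH.neg

theorem mulVec {B : E d → Mat m} (hB : MatLinfty B μ) (hF : IsL2Field μ F) :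
    IsL2Field μ fun W x => B x *ᵥ F W x where
  vecL2 W := (hF.vecL2 W).mulVec hB
  map_add W W' := by
    filter_upwards [hF.map_add W W'] with x h1
    rw [h1, Matrix.mulVec_add]
  map_smul c W := by
    filter_upwards [hF.map_smul c W] with x h1
    rw [h1, Matrix.mulVec_smul]

theorem sum {ι : Type*} {s : Finset ι} {F : ι → X → E d → Fin m → ℝ}
    (hF : ∀ k ∈ s, IsL2Field μ (F k)) : IsL2Field μ fun W x => ∑ k ∈ s, F k W x where
  vecL2 W := VecL2.sum fun k hk => (hF k hk).vecL2 W
  map_add W W' := by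
    have := (s.eventually_all (l := ae μ)).2 fun k hk => (hF k hk).map_add W W'
    filter_upwards [this] with x h1
    rw [Finset.sum_congr rfl h1, Finset.sum_add_distrib]
  map_smul c W := by
    have := (s.eventually_all (l := ae μ)).2 fun k hk => (hF k hk).map_smul c W
    filter_upwards [this] with x h1
    rw [Finset.sum_congr rfl h1, Finset.smul_sum]

end IsL2Field

/-- A function of two variables that is bilinear. -/
def IsBilin (b : X → X → ℝ) : Prop := ∃ Φ : X →ₗ[ℝ] X →ₗ[ℝ] ℝ, ∀ W δ, Φ W δ = b W δ

theorem IsBilin.add {b c : X → X → ℝ} (hb : IsBilin b) (hc : IsBilin c) :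
    IsBilin fun W δ => b W δ + c W δ := by
  obtain ⟨Φ, h⟩ := hb
  obtain ⟨Ψ, h'⟩ := hc
  exact ⟨Φ + Ψ, fun W δ => by simp [h, h']⟩

theorem IsBilin.sub {b c : X → X → ℝ} (hb : IsBilin b) (hc : IsBilin c) :
    IsBilin fun W δ => b W δ - c W δ := by
  obtain ⟨Φ, h⟩ := hb
  obtain ⟨Ψ, h'⟩ := hc
  exact ⟨Φ - Ψ, fun W δ => by simp [h, h']⟩

theorem IsBilin.sum {ι : Type*} {s : Finset ι} {b : ι → X → X → ℝ}
    (hb : ∀ k ∈ s, IsBilin (b k)) : IsBilin fun W δ => ∑ k ∈ s, b k W δ := by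
  classical
  induction s using Finset.induction_on with
  | empty => exact ⟨0, fun W δ => by simp⟩
  | insert a s ha ih =>
    simp only [Finset.sum_insert ha]
    exact (hb a (Finset.mem_insert_self a s)).add
      (ih fun k hk => hb k (Finset.mem_insert_of_mem hk))

/-- Linearity up to null sets suffices under the integral. Square integrability is essential:
without integrability the integral takes its default value 0 and additivity may fail. -/
theorem IsL2Field.isBilin {F H : X → E d → Fin m → ℝ} (hF : IsL2Field μ F)
    (hH : IsL2Field μ H) : IsBilin fun W δ => ∫ x, F W x ⬝ᵥ H δ x ∂μ := by
  have hint : ∀ W δ, Integrable (fun x => F W x ⬝ᵥ H δ x) μ := fun W δ =>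
    (hF.vecL2 W).integrable_dotProduct (hH.vecL2 δ)
  refine ⟨LinearMap.mk₂ ℝ (fun W δ => ∫ x, F W x ⬝ᵥ H δ x ∂μ) ?_ ?_ ?_ ?_, fun W δ => rfl⟩
  · intro W W' δ
    rw [← integral_add (hint _ _) (hint _ _)]
    refine integral_congr_ae ?_
    filter_upwards [hF.map_add W W'] with x hx
    rw [hx, add_dotProduct]
  · intro c W δ
    rw [smul_eq_mul, ← integral_const_mul]
    refine integral_congr_ae ?_
    filter_upwards [hF.map_smul c W] with x hx
    rw [hx, smul_dotProduct, smul_eq_mul]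
  · intro W δ δ'
    rw [← integral_add (hint _ _) (hint _ _)]
    refine integral_congr_ae ?_
    filter_upwards [hH.map_add δ δ'] with x hx
    rw [hx, dotProduct_add]
  · intro c W δ
    rw [smul_eq_mul, ← integral_const_mul]
    refine integral_congr_ae ?_
    filter_upwards [hH.map_smul c δ] with x hx
    rw [hx, dotProduct_smul, smul_eq_mul]

end L2Field

/-! ### Polynomials as smooth functions on Euclidean space -/

section Polynomials

variable {d : ℕ}

/-- The polynomial function of `q` on Euclidean space. -/
noncomputable def evalE (q : MvPolynomial (Fin d) ℝ) (x : E d) : ℝ := MvPolynomial.eval (fun k => x k) q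

theorem contDiff_evalE (q : MvPolynomial (Fin d) ℝ) : ContDiff ℝ ∞ (evalE q) := by
  unfold evalE
  induction q using MvPolynomial.induction_on with
  | C a => simpa using contDiff_const
  | add p q hp hq => simpa using hp.add hq
  | mul_X p i hp =>
    simp only [map_mul, MvPolynomial.eval_X]
    exact hp.mul (EuclideanSpace.proj i : E d →L[ℝ] ℝ).contDiff

theorem continuous_evalE (q : MvPolynomial (Fin d) ℝ) : Continuous (evalE q) :=
  (contDiff_evalE q).continuous

theorem differentiableAt_evalE (q : MvPolynomial (Fin d) ℝ) (x : E d) :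
    DifferentiableAt ℝ (evalE q) x :=
  (contDiff_evalE q).contDiffAt.differentiableAt (by simp)

theorem pd_mul {φ ψ : E d → ℝ} {x : E d} (hφ : DifferentiableAt ℝ φ x)
    (hψ : DifferentiableAt ℝ ψ x) (k : Fin d) :
    pd k (fun y => φ y * ψ y) x = φ x * pd k ψ x + ψ x * pd k φ x := by
  simp [pd, fderiv_fun_mul hφ hψ]

theorem pd_evalE (k : Fin d) (q : MvPolynomial (Fin d) ℝ) (x : E d) :
    pd k (evalE q) x = evalE (MvPolynomial.pderiv k q) x := by
  induction q using MvPolynomial.induction_on with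
  | C a =>
    have : evalE (MvPolynomial.C a : MvPolynomial (Fin d) ℝ) = fun _ => a := by
      funext y
      simp [evalE]
    simp [pd, this, evalE]
  | add p q hp hq =>
    have : evalE (p + q) = fun y => evalE p y + evalE q y := by
      funext y
      simp [evalE]
    rw [this, pd, fderiv_fun_add (differentiableAt_evalE p x) (differentiableAt_evalE q x)]
    simp only [pd] at hp hq
    simp [hp, hq, evalE]
  | mul_X p i hp =>
    have : evalE (p * MvPolynomial.X i) =
        fun y => evalE p y * (EuclideanSpace.proj i : E d →L[ℝ] ℝ) y := by
      funext y
      simp [evalE]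
    have hX : pd k (EuclideanSpace.proj i : E d →L[ℝ] ℝ) x = if i = k then 1 else 0 := by
      rw [pd, ContinuousLinearMap.fderiv]
      simp
    rw [this, pd_mul (differentiableAt_evalE p x) (ContinuousLinearMap.differentiableAt _), hp, hX]
    rcases eq_or_ne i k with rfl | h
    · simp [evalE]
    · simp [evalE, MvPolynomial.pderiv_X_of_ne h, h]

/-- A measure of finite mass that is concentrated on a compact set. -/
structure CompactlyConcentrated (μ : Measure (E d)) : Prop where
  finite : IsFiniteMeasure μ
  compact : ∃ C : Set (E d), IsCompact C ∧ ∀ᵐ x ∂μ, x ∈ C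

theorem CompactlyConcentrated.memLp_of_continuous {μ : Measure (E d)}
    (hμ : CompactlyConcentrated μ) {φ : E d → ℝ} (hφ : Continuous φ) (r : ENNReal) :
    MemLp φ r μ := by
  have := hμ.finite
  obtain ⟨C, hC, hC'⟩ := hμ.compact
  obtain ⟨b, hb⟩ := hC.exists_bound_of_continuousOn hφ.continuousOn
  exact MemLp.of_bound hφ.aestronglyMeasurable b (hC'.mono fun x hx => hb x hx)

theorem CompactlyConcentrated.restrict {ν : Measure (E d)} {s C : Set (E d)} (hC : IsCompact C)
    (hs : s ⊆ C) (hfin : ν C < ⊤) : CompactlyConcentrated (ν.restrict s) where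
  finite := ⟨by
    rw [Measure.restrict_apply_univ]
    exact (measure_mono hs).trans_lt hfin⟩
  compact := ⟨C, hC, (ae_mono (Measure.restrict_mono hs le_rfl))
    (ae_restrict_mem hC.measurableSet)⟩

/-- A polynomial that vanishes almost everywhere on a nonempty open set is zero. -/
theorem eq_zero_of_ae_evalE_eq_zero {q : MvPolynomial (Fin d) ℝ} {U : Set (E d)}
    (hU : IsOpen U) (hne : U.Nonempty) (h : ∀ᵐ x ∂(volume.restrict U), evalE q x = 0) : q = 0 := by
  have h1 : Set.EqOn (evalE q) (fun _ => 0) U :=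
    Measure.eqOn_open_of_ae_eq h hU (continuous_evalE q).continuousOn continuousOn_const
  obtain ⟨x₀, hx₀⟩ := hne
  -- In the sup norm balls are boxes, so the polynomial vanishes on a product of infinite sets,
  -- which forces it to be zero.
  have hV : IsOpen ((WithLp.toLp 2 : (Fin d → ℝ) → E d) ⁻¹' U) :=
    hU.preimage (PiLp.continuous_toLp 2 _)
  obtain ⟨ε, hε, hball⟩ := Metric.isOpen_iff.1 hV (WithLp.ofLp x₀) hx₀
  refine MvPolynomial.funext_set (fun i => Metric.ball (x₀ i) ε) (fun i => ?_) fun x hx => ?_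
  · rw [Real.ball_eq_Ioo]
    exact Set.Ioo_infinite (by linarith)
  · rw [map_zero]
    rw [← ball_pi _ hε] at hx
    exact h1 (hball hx)

end Polynomials

/-! ### Surface measure on element boundaries and mortars -/

section MeshMeasures

variable {d : ℕ} {Ω : Set (E d)} {𝒯 ℰ : Type*} (mesh : Mesh d Ω 𝒯 ℰ)

theorem Mesh.isOpen_elem (K : 𝒯) : IsOpen (mesh.elem K) := isOpen_openSimplex _

theorem Mesh.compactlyConcentrated_elem (K : 𝒯) :
    CompactlyConcentrated (volume.restrict (mesh.elem K)) :=
  CompactlyConcentrated.restrict (isCompact_closure_openSimplex (mesh.simplex K)) subset_closure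
    (isCompact_closure_openSimplex (mesh.simplex K)).measure_lt_top

theorem Mesh.compactlyConcentrated_mMeas (hd : 0 < d) {e : ℰ} {K : 𝒯} (hK : K ∈ mesh.sides e) :
    CompactlyConcentrated (mesh.mMeas e) := by
  obtain ⟨a, ha⟩ := mesh.mortar_flat e K hK
  exact CompactlyConcentrated.restrict (isCompact_facet _ a) ha (surf_facet_lt_top _ hd a)

theorem Mesh.sides_nonempty (e : ℰ) : (mesh.sides e).Nonempty := by
  rw [← Finset.card_pos]
  rcases mesh.card_sides e with h | h <;> omega

theorem Mesh.mortar_subset_frontier {e : ℰ} {K : 𝒯} (hK : K ∈ mesh.sides e) :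
    mesh.mortar e ⊆ frontier (mesh.elem K) := by
  obtain ⟨a, ha⟩ := mesh.mortar_flat e K hK
  exact ha.trans (facet_subset_frontier _ a)

theorem Mesh.mMeas_le {e : ℰ} {K : 𝒯} (hK : K ∈ mesh.sides e) :
    mesh.mMeas e ≤ (surf d).restrict (frontier (mesh.elem K)) :=
  Measure.restrict_mono (mesh.mortar_subset_frontier hK) le_rfl

open Classical in
/-- The surface measure on `∂K` is the sum of the surface measures on the mortars of `K`. -/
theorem Mesh.surf_restrict_frontier [Fintype ℰ] (K : 𝒯) :
    (surf d).restrict (frontier (mesh.elem K)) = ∑ e with K ∈ mesh.sides e, mesh.mMeas e := by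
  have hU : frontier (mesh.elem K) =ᵐ[surf d]
      ⋃ e : {e : ℰ // K ∈ mesh.sides e}, mesh.mortar e := by
    refine Filter.EventuallyLE.antisymm ?_ ?_
    · rw [ae_le_set]
      have := mesh.mortar_cover K
      rwa [← Set.iUnion_subtype (fun e => K ∈ mesh.sides e) (fun e => mesh.mortar e)] at this
    · exact (Set.iUnion_subset fun e => mesh.mortar_subset_frontier e.2).eventuallyLE
  rw [Measure.restrict_congr_set hU, Measure.restrict_iUnion_ae, Measure.sum_fintype]
  · rw [Finset.sum_subtype (Finset.univ.filter fun e => K ∈ mesh.sides e)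
      (p := fun e => K ∈ mesh.sides e) (by simp)]
    rfl
  · intro e e' h
    exact mesh.mortar_disjoint fun h' => h (Subtype.ext h')
  · exact fun e => (mesh.mortar_measurable e).nullMeasurableSet

/-- The (d-1)-dimensional Hausdorff measure is not locally finite on the whole space; finiteness on
∂K comes from the finitely many mortars, each inside a facet. -/
theorem Mesh.isFiniteMeasure_frontier [Fintype ℰ] (hd : 0 < d) (K : 𝒯) :
    IsFiniteMeasure ((surf d).restrict (frontier (mesh.elem K))) := by
  classical
  refine ⟨?_⟩
  rw [mesh.surf_restrict_frontier, Measure.finsetSum_apply]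
  refine ENNReal.sum_lt_top.2 fun e he => ?_
  have := (mesh.compactlyConcentrated_mMeas hd (Finset.mem_filter.1 he).2).finite
  exact measure_lt_top _ _

end MeshMeasures

/-! ### Symmetry of the weak divergence and of the normal trace -/

section Symmetry

variable {d m : ℕ} {Ω : Set (E d)} {A : Fin d → E d → Mat m} {D G : E d → Mat m}

theorem integrable_bounded_mul_of_hasCompactSupport {μ : Measure (E d)} {b g : E d → ℝ}
    [IsFiniteMeasureOnCompacts μ]
    (hb : MemLp b ⊤ μ) (hg : Continuous g) (hgc : HasCompactSupport g) :
    Integrable (fun x => b x * g x) μ :=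
  hb.integrable_mul (hg.memLp_of_hasCompactSupport (p := 1) hgc)

/-- The weak divergence of symmetric fields is symmetric. -/
theorem OneFieldFriedrichs.symm_div (hΩ : IsOpen Ω) (hA : OneFieldFriedrichs Ω A D G) :
    ∀ᵐ x ∂(volume.restrict Ω), (D x)ᵀ = D x := by
  have key : ∀ i j, ∀ᵐ x ∂(volume : Measure (E d)), x ∈ Ω → D x i j - D x j i = 0 := by
    intro i j
    refine hΩ.ae_eq_zero_of_integral_contDiff_smul_eq_zero ?_ ?_
    · have h : MemLp (fun x => D x i j - D x j i) ⊤ (volume.restrict Ω) :=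
        (hA.D_bdd i j).sub (hA.D_bdd j i)
      exact locallyIntegrableOn_of_locallyIntegrable_restrict (h.locallyIntegrable le_top)
    · intro g hg hgc hgs
      have h1 : ∫ x, g x • (D x i j - D x j i) = ∫ x in Ω, (D x i j * g x - D x j i * g x) := by
        rw [setIntegral_eq_integral_of_forall_compl_eq_zero]
        · exact integral_congr_ae (.of_forall fun x => by simp only [smul_eq_mul]; ring)
        · intro x hx
          have : g x = 0 := image_eq_zero_of_notMem_tsupport fun h => hx (hgs h)
          rw [this]
          ring
      -- Tested against the same function, the (i, j) and (j, i) entries of D see equal integrals,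
      -- because every `A k` is symmetric.
      have h2 : ∫ x in Ω, ∑ k, A k x i j * pd k g x = ∫ x in Ω, ∑ k, A k x j i * pd k g x := by
        refine integral_congr_ae ?_
        filter_upwards [ae_all_iff.2 hA.symm] with x hx
        refine Finset.sum_congr rfl fun k _ => ?_
        rw [hx k, Matrix.transpose_apply, ← hx k]
      rw [h1, integral_sub
        (integrable_bounded_mul_of_hasCompactSupport (hA.D_bdd i j) hg.continuous hgc)
        (integrable_bounded_mul_of_hasCompactSupport (hA.D_bdd j i) hg.continuous hgc)]
      have h3 := hA.weakDiv g hg hgc hgs i j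
      have h4 := hA.weakDiv g hg hgc hgs j i
      linarith
  filter_upwards [ae_restrict_of_ae (ae_all_iff.2 fun i => ae_all_iff.2 (key i)),
    ae_restrict_mem hΩ.measurableSet] with x hx hxΩ
  ext i j
  exact sub_eq_zero.1 (hx j i hxΩ)

/-- The normal trace of symmetric fields is symmetric. -/
theorem IsNormalTrace.symm {K : Set (E d)} {N : E d → Mat m} (hN : IsNormalTrace K A D N)
    [IsFiniteMeasure ((surf d).restrict (frontier K))]
    (hAs : ∀ k, ∀ᵐ x ∂(volume.restrict K), A k x = (A k x)ᵀ)
    (hDs : ∀ᵐ x ∂(volume.restrict K), (D x)ᵀ = D x) :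
    ∀ᵐ x ∂((surf d).restrict (frontier K)), (N x).IsHermitian := by
  have key : ∀ i j, ∀ᵐ x ∂((surf d).restrict (frontier K)), N x i j - N x j i = 0 := by
    intro i j
    refine ae_eq_zero_of_integral_contDiff_smul_eq_zero ?_ ?_
    · exact ((hN.bdd i j).sub (hN.bdd j i)).locallyIntegrable le_top
    · intro g hg hgc
      have h1 : ∫ x in frontier K, g x • (N x i j - N x j i) ∂(surf d) =
          ∫ x in frontier K, (N x i j * g x - N x j i * g x) ∂(surf d) :=
        integral_congr_ae (.of_forall fun x => by simp only [smul_eq_mul]; ring)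
      rw [h1, integral_sub
        (integrable_bounded_mul_of_hasCompactSupport (hN.bdd i j) hg.continuous hgc)
        (integrable_bounded_mul_of_hasCompactSupport (hN.bdd j i) hg.continuous hgc),
        hN.green g hg, hN.green g hg, sub_eq_zero]
      -- Green's formula has turned both boundary integrals into volume integrals, which agree by
      -- the symmetry of `A k` and `D`.
      refine integral_congr_ae ?_
      filter_upwards [ae_all_iff.2 hAs, hDs] with x hx hx'
      congr 1
      · refine Finset.sum_congr rfl fun k _ => ?_
        rw [hx k, Matrix.transpose_apply, ← hx k]
      · rw [← hx', Matrix.transpose_apply, hx']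
  filter_upwards [ae_all_iff.2 fun i => ae_all_iff.2 (key i)] with x hx
  ext i j
  simpa using sub_eq_zero.1 (hx j i)

end Symmetry

/-! ### The discrete unknowns as fields; finite dimension of the trace space -/

section Fields

variable {d m : ℕ} {Ω : Set (E d)} {𝒯 ℰ : Type*} {mesh : Mesh d Ω 𝒯 ℰ} {p : 𝒯 → ℕ}

theorem polyVal_apply {q : ℕ} (w : Fin m → Poly d q) (x : E d) (i : Fin m) :
    polyVal w x i = evalE (w i : MvPolynomial (Fin d) ℝ) x := rfl

theorem polyPd_apply {q : ℕ} (k : Fin d) (w : Fin m → Poly d q) (x : E d) (i : Fin m) :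
    polyPd k w x i = pd k (evalE (w i : MvPolynomial (Fin d) ℝ)) x := by
  rw [pd_evalE]
  rfl

theorem isL2Field_polyVal {μ : Measure (E d)} (hμ : CompactlyConcentrated μ) (K : 𝒯) :
    IsL2Field μ fun W : VolSpace d p m × TraceSpace mesh p m => polyVal (W.1 K) where
  vecL2 W i := hμ.memLp_of_continuous (continuous_evalE _) 2
  map_add W W' := .of_forall fun x => by
    funext i
    simp [polyVal]
  map_smul c W := .of_forall fun x => by
    funext i
    simp [polyVal, MvPolynomial.smul_eval]

theorem isL2Field_polyPd {μ : Measure (E d)} (hμ : CompactlyConcentrated μ) (K : 𝒯) (k : Fin d) :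
    IsL2Field μ fun W : VolSpace d p m × TraceSpace mesh p m => polyPd k (W.1 K) where
  vecL2 W i := hμ.memLp_of_continuous (continuous_evalE _) 2
  map_add W W' := .of_forall fun x => by
    funext i
    simp [polyPd]
  map_smul c W := .of_forall fun x => by
    funext i
    simp [polyPd, MvPolynomial.smul_eval]

theorem isL2Field_traceVal (e : ℰ) :
    IsL2Field (mesh.mMeas e)
      fun W : VolSpace d p m × TraceSpace mesh p m => traceVal (W.2 e) where
  vecL2 W i := Lp.memLp (W.2 e i : Lp ℝ 2 (mesh.mMeas e))
  map_add W W' := by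
    filter_upwards [ae_all_iff.2 fun i => Lp.coeFn_add (W.2 e i : Lp ℝ 2 (mesh.mMeas e))
      (W'.2 e i)] with x hx
    funext i
    exact hx i
  map_smul c W := by
    filter_upwards [ae_all_iff.2 fun i => Lp.coeFn_smul c
      (W.2 e i : Lp ℝ 2 (mesh.mMeas e))] with x hx
    funext i
    exact hx i

theorem isL2Field_adjFlux {N : 𝒯 → E d → Mat m} {K : 𝒯} {e : ℰ}
    (hμ : CompactlyConcentrated (mesh.mMeas e)) (hN : MatLinfty (N K) (mesh.mMeas e))
    (hs : ∀ᵐ x ∂(mesh.mMeas e), (N K x).IsHermitian) :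
    IsL2Field (mesh.mMeas e) fun W : VolSpace d p m × TraceSpace mesh p m =>
      adjFlux mesh p N W.1 W.2 K e :=
  ((isL2Field_traceVal (p := p) (m := m) e).mulVec hN).neg.add
    (((isL2Field_polyVal (p := p) (m := m) hμ K).sub
      (isL2Field_traceVal (p := p) (m := m) e)).mulVec (hN.absMat hs))

/-- The polynomials in `L²(μ)` form a finite-dimensional space. -/
instance finite_polyL2 (q : ℕ) (μ : Measure (E d)) : Module.Finite ℝ (polyL2 q μ) := by
  -- For a general measure not every polynomial is square integrable. Those that are form a subspace
  -- of a finite-dimensional space, and `T` maps it onto `polyL2 q μ`.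
  let S : Submodule ℝ (Poly d q) :=
    { carrier := {r | MemLp (evalE (r : MvPolynomial (Fin d) ℝ)) 2 μ}
      zero_mem' := by
        have : evalE (0 : MvPolynomial (Fin d) ℝ) = fun _ => 0 := by
          funext x
          simp [evalE]
        simp [this]
      add_mem' := by
        intro a b ha hb
        have : evalE ((a + b : Poly d q) : MvPolynomial (Fin d) ℝ) = evalE a.1 + evalE b.1 := by
          funext x
          simp [evalE]
        simp only [Set.mem_ofPred_eq, this]
        exact ha.add hb
      smul_mem' := by
        intro c a ha
        have : evalE ((c • a : Poly d q) : MvPolynomial (Fin d) ℝ) = c • evalE a.1 := by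
          funext x
          simp [evalE, MvPolynomial.smul_eval]
        simp only [Set.mem_ofPred_eq, this]
        exact ha.const_smul c }
  let T : S →ₗ[ℝ] Lp ℝ 2 μ :=
    { toFun := fun r => MemLp.toLp _ r.2
      map_add' := by
        intro a b
        rw [← MemLp.toLp_add]
        refine MemLp.toLp_congr _ _ (.of_forall fun x => ?_)
        simp [evalE]
      map_smul' := by
        intro c a
        rw [RingHom.id_apply, ← MemLp.toLp_const_smul]
        refine MemLp.toLp_congr _ _ (.of_forall fun x => ?_)
        simp [evalE, MvPolynomial.smul_eval] }
  have hle : polyL2 q μ ≤ LinearMap.range T := by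
    rintro f ⟨r, hr, hf⟩
    have hr2 : MemLp (evalE r) 2 μ := (memLp_congr_ae hf).1 (Lp.memLp f)
    refine ⟨⟨⟨r, hr⟩, hr2⟩, ?_⟩
    exact Lp.ext ((MemLp.coeFn_toLp hr2).trans hf.symm)
  exact Submodule.finiteDimensional_of_le hle

end Fields

/-! ### Pointwise algebra of the flux and boundary terms -/

section Pointwise

variable {m : ℕ}

theorem transpose_mulVec_dotProduct (B : Mat m) (u v : Fin m → ℝ) :
    (Bᵀ *ᵥ u) ⬝ᵥ v = u ⬝ᵥ (B *ᵥ v) := by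
  rw [Matrix.mulVec_transpose, ← Matrix.dotProduct_mulVec]

theorem dotProduct_mulVec_comm {B : Mat m} (hB : B.IsHermitian) (u v : Fin m → ℝ) :
    u ⬝ᵥ (B *ᵥ v) = v ⬝ᵥ (B *ᵥ u) := by
  rw [← transpose_mulVec_dotProduct, show Bᵀ = B from hB, dotProduct_comm]

theorem dotProduct_add_transpose (G D : Mat m) (v : Fin m → ℝ) :
    v ⬝ᵥ ((G + Gᵀ + D) *ᵥ v) = 2 * ((Gᵀ *ᵥ v) ⬝ᵥ v) + v ⬝ᵥ (D *ᵥ v) := by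
  rw [Matrix.add_mulVec, Matrix.add_mulVec, dotProduct_add, dotProduct_add,
    transpose_mulVec_dotProduct, dotProduct_comm v (Gᵀ *ᵥ v), transpose_mulVec_dotProduct]
  ring

/-- Completing the square in the flux term; `w` and `z` are the values of the volume and of the
trace variable. -/
theorem flux_dotProduct_identity {B S : Mat m} (hB : B.IsHermitian) (w z : Fin m → ℝ) :
    (-(B *ᵥ z) + S *ᵥ (w - z)) ⬝ᵥ w - (-(B *ᵥ z) + S *ᵥ (w - z)) ⬝ᵥ z +
        (1 / 2) * (w ⬝ᵥ (B *ᵥ w)) =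
      (1 / 2) * (z ⬝ᵥ (B *ᵥ z)) +
        (w - z) ⬝ᵥ ((S + (1 / 2 : ℝ) • B) *ᵥ (w - z)) := by
  rw [← dotProduct_sub]
  obtain ⟨u, rfl⟩ : ∃ u, w = u + z := ⟨w - z, by abel⟩
  rw [add_sub_cancel_right]
  simp only [Matrix.add_mulVec, Matrix.mulVec_add, add_dotProduct, dotProduct_add, neg_dotProduct,
    Matrix.smul_mulVec, dotProduct_smul, smul_eq_mul]
  rw [dotProduct_mulVec_comm hB z u, dotProduct_comm (B *ᵥ z) u, dotProduct_comm (S *ᵥ u) u]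
  ring

theorem boundary_dotProduct_identity (B M : Mat m) (z : Fin m → ℝ) :
    ((1 / 2 : ℝ) • ((-B + M)ᵀ *ᵥ z)) ⬝ᵥ z =
      (1 / 2) * (z ⬝ᵥ (M *ᵥ z)) - (1 / 2) * (z ⬝ᵥ (B *ᵥ z)) := by
  rw [smul_dotProduct, transpose_mulVec_dotProduct, Matrix.add_mulVec, dotProduct_add,
    Matrix.neg_mulVec, dotProduct_neg, smul_eq_mul]
  ring

end Pointwise

/-! ### Green's formula for quadratic forms of polynomials -/

section Green

variable {d m : ℕ} {K : Set (E d)} {A : Fin d → E d → Mat m} {D N : E d → Mat m}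

theorem continuous_pd {φ : E d → ℝ} (hφ : ContDiff ℝ ∞ φ) (k : Fin d) : Continuous (pd k φ) :=
  (hφ.continuous_fderiv (by simp)).clm_apply continuous_const

theorem CompactlyConcentrated.integrable_bounded_mul {μ : Measure (E d)}
    (hμ : CompactlyConcentrated μ) {b φ : E d → ℝ} (hb : MemLp b ⊤ μ) (hφ : Continuous φ) :
    Integrable (fun x => b x * φ x) μ :=
  hb.integrable_mul (hμ.memLp_of_continuous hφ 1)

theorem dotProduct_mulVec_eq_sum (B : Mat m) (u v : Fin m → ℝ) :
    u ⬝ᵥ (B *ᵥ v) = ∑ i, ∑ j, B i j * (u i * v j) := by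
  simp only [dotProduct, Matrix.mulVec, Finset.mul_sum]
  exact Finset.sum_congr rfl fun i _ => Finset.sum_congr rfl fun j _ => by ring

/-- Green's formula for the quadratic form of the normal trace. -/
theorem IsNormalTrace.green_quadratic (hN : IsNormalTrace K A D N)
    (hK : CompactlyConcentrated (volume.restrict K))
    (hF : CompactlyConcentrated ((surf d).restrict (frontier K)))
    (hAb : ∀ k, MatLinfty (A k) (volume.restrict K)) (hDb : MatLinfty D (volume.restrict K))
    (hAs : ∀ k, ∀ᵐ x ∂(volume.restrict K), A k x = (A k x)ᵀ)
    {q : ℕ} (w : Fin m → Poly d q) :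
    ∫ x in frontier K, polyVal w x ⬝ᵥ (N x *ᵥ polyVal w x) ∂(surf d) =
      ∫ x in K, (2 * (polyVal w x ⬝ᵥ (D x *ᵥ polyVal w x + ∑ k, A k x *ᵥ polyPd k w x)) -
        polyVal w x ⬝ᵥ (D x *ᵥ polyVal w x)) := by
  let P : Fin m → E d → ℝ := fun i => evalE (w i : MvPolynomial (Fin d) ℝ)
  -- The products of components of w serve as the scalar test functions in Green's formula, one for
  -- each matrix entry.
  have hP : ∀ i j, ContDiff ℝ ∞ fun x => P i x * P j x := fun i j =>
    (contDiff_evalE _).mul (contDiff_evalE _)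
  have hD1 : ∀ i j, Integrable (fun x => ((∑ k, A k x i j * pd k (fun x => P i x * P j x) x) +
      D x i j * (P i x * P j x))) (volume.restrict K) := fun i j =>
    (integrable_finsetSum _ fun k _ => hK.integrable_bounded_mul (hAb k i j)
      (continuous_pd (hP i j) k)).add (hK.integrable_bounded_mul (hDb i j) (hP i j).continuous)
  have hL : ∀ x, polyVal w x ⬝ᵥ (N x *ᵥ polyVal w x) = ∑ i, ∑ j, N x i j * (P i x * P j x) :=
    fun x => dotProduct_mulVec_eq_sum _ _ _
  have hN1 : ∀ i j, Integrable (fun x => N x i j * (P i x * P j x))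
      ((surf d).restrict (frontier K)) := fun i j =>
    hF.integrable_bounded_mul (hN.bdd i j) (hP i j).continuous
  simp only [hL]
  rw [integral_finsetSum _ fun i _ => integrable_finsetSum _ fun j _ => hN1 i j]
  simp only [integral_finsetSum _ fun j _ => hN1 _ j, hN.green _ (hP _ _)]
  simp only [← integral_finsetSum _ fun j _ => hD1 _ j]
  rw [← integral_finsetSum _ fun i _ => integrable_finsetSum _ fun j _ => hD1 i j]
  refine integral_congr_ae ?_
  filter_upwards [ae_all_iff.2 hAs] with x hx
  have hpd : ∀ i j k, pd k (fun x => P i x * P j x) x =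
      polyVal w x i * polyPd k w x j + polyPd k w x i * polyVal w x j := by
    intro i j k
    rw [pd_mul (differentiableAt_evalE _ x) (differentiableAt_evalE _ x), polyPd_apply,
      polyPd_apply]
    simp only [polyVal_apply]
    ring
  -- The product rule yields two terms, equal by the symmetry of `A k`; hence the factor 2.
  have hA1 : ∀ k, ∑ i, ∑ j, A k x i j * pd k (fun x => P i x * P j x) x =
      2 * (polyVal w x ⬝ᵥ (A k x *ᵥ polyPd k w x)) := by
    intro k
    have hs : (A k x).IsHermitian := (hx k).symm
    simp only [hpd, mul_add, Finset.sum_add_distrib]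
    rw [← dotProduct_mulVec_eq_sum, ← dotProduct_mulVec_eq_sum,
      dotProduct_mulVec_comm hs (polyPd k w x)]
    ring
  have hS : ∑ i, ∑ j, ∑ k, A k x i j * pd k (fun x => P i x * P j x) x =
      ∑ k, 2 * (polyVal w x ⬝ᵥ (A k x *ᵥ polyPd k w x)) := by
    simp only [← hA1]
    rw [Finset.sum_comm (s := Finset.univ (α := Fin d))]
    exact Finset.sum_congr rfl fun i _ => Finset.sum_comm
  have hDx : ∑ i, ∑ j, D x i j * (P i x * P j x) = polyVal w x ⬝ᵥ (D x *ᵥ polyVal w x) :=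
    (dotProduct_mulVec_eq_sum _ _ _).symm
  simp only [Finset.sum_add_distrib]
  rw [hS, hDx, dotProduct_add, dotProduct_sum, ← Finset.mul_sum]
  ring

end Green

/-! ### Local energy and coercivity -/

section Local

variable {d m : ℕ} {K : Set (E d)} {A : Fin d → E d → Mat m} {D G N : E d → Mat m}

/-- Integration by parts in the diagonal of the local form. -/
theorem IsNormalTrace.local_energy (hN : IsNormalTrace K A D N)
    (hK : CompactlyConcentrated (volume.restrict K))
    (hF : CompactlyConcentrated ((surf d).restrict (frontier K)))
    (hGb : MatLinfty G (volume.restrict K))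
    (hAb : ∀ k, MatLinfty (A k) (volume.restrict K)) (hDb : MatLinfty D (volume.restrict K))
    (hAs : ∀ k, ∀ᵐ x ∂(volume.restrict K), A k x = (A k x)ᵀ)
    {q : ℕ} (w : Fin m → Poly d q) :
    (∫ x in K, polyVal w x ⬝ᵥ (D x *ᵥ polyVal w x + ∑ k, A k x *ᵥ polyPd k w x)) +
        ∫ x in K, ((G x)ᵀ *ᵥ polyVal w x) ⬝ᵥ polyVal w x =
      (1 / 2) * (∫ x in K, polyVal w x ⬝ᵥ ((G x + (G x)ᵀ + D x) *ᵥ polyVal w x)) +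
        (1 / 2) * ∫ x in frontier K, polyVal w x ⬝ᵥ (N x *ᵥ polyVal w x) ∂(surf d) := by
  have hw : VecL2 (polyVal w) (volume.restrict K) := fun i =>
    hK.memLp_of_continuous (continuous_evalE _) 2
  have hpw : ∀ k, VecL2 (polyPd k w) (volume.restrict K) := fun k i =>
    hK.memLp_of_continuous (continuous_evalE _) 2
  have h1 := hw.integrable_dotProduct
    ((hw.mulVec hDb).add (VecL2.sum (s := Finset.univ) fun k _ => (hpw k).mulVec (hAb k)))
  have h2 := hw.integrable_dotProduct (hw.mulVec hDb)
  have h3 := (hw.mulVec hGb.transpose).integrable_dotProduct hw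
  rw [hN.green_quadratic hK hF hAb hDb hAs w]
  simp only [dotProduct_add_transpose]
  rw [integral_add (h3.const_mul 2) h2, integral_sub (h1.const_mul 2) h2, integral_const_mul,
    integral_const_mul]
  ring

/-- Coercivity of the zero-order term. -/
theorem ae_eq_zero_of_integral_coercive {B : E d → Mat m} {μ : Measure (E d)}
    {f : E d → Fin m → ℝ} (hf : VecL2 f μ) (hB : MatLinfty B μ) {c : ℝ} (hc : 0 < c)
    (hpos : ∀ᵐ x ∂μ, SemiPos (B x - c • (1 : Mat m))) :
    0 ≤ ∫ x, f x ⬝ᵥ (B x *ᵥ f x) ∂μ ∧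
      (∫ x, f x ⬝ᵥ (B x *ᵥ f x) ∂μ = 0 → ∀ᵐ x ∂μ, f x = 0) := by
  have hle : ∀ᵐ x ∂μ, c * (f x ⬝ᵥ f x) ≤ f x ⬝ᵥ (B x *ᵥ f x) := by
    filter_upwards [hpos] with x hx
    have := hx (f x)
    rw [Matrix.sub_mulVec, dotProduct_sub, Matrix.smul_mulVec, Matrix.one_mulVec,
      dotProduct_smul, smul_eq_mul] at this
    linarith
  have hsq : ∀ x, 0 ≤ f x ⬝ᵥ f x := fun x => Finset.sum_nonneg fun i _ => mul_self_nonneg _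
  have hnn : ∀ᵐ x ∂μ, 0 ≤ f x ⬝ᵥ (B x *ᵥ f x) :=
    hle.mono fun x hx => (mul_nonneg hc.le (hsq x)).trans hx
  refine ⟨integral_nonneg_of_ae hnn, fun h0 => ?_⟩
  have h1 := (integral_eq_zero_iff_of_nonneg_ae hnn (hf.integrable_dotProduct (hf.mulVec hB))).1 h0
  filter_upwards [hle, h1] with x hx hx0
  rw [hx0, Pi.zero_apply] at hx
  have : f x ⬝ᵥ f x = 0 := le_antisymm (by nlinarith [hsq x]) (hsq x)
  exact dotProduct_self_eq_zero.1 this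

/-- Coercivity of the flux term. -/
theorem ae_eq_zero_of_integral_absMat {B : E d → Mat m} {μ : Measure (E d)}
    {f : E d → Fin m → ℝ} (hf : VecL2 f μ) (hB : MatLinfty B μ)
    (hs : ∀ᵐ x ∂μ, (B x).IsHermitian)
    (hnull : ∀ᵐ x ∂μ, ∀ v : Fin m → ℝ, B x *ᵥ v = 0 → v = 0) :
    0 ≤ ∫ x, f x ⬝ᵥ ((absMat (B x) + (1 / 2 : ℝ) • B x) *ᵥ f x) ∂μ ∧
      (∫ x, f x ⬝ᵥ ((absMat (B x) + (1 / 2 : ℝ) • B x) *ᵥ f x) ∂μ = 0 →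
        ∀ᵐ x ∂μ, f x = 0) := by
  have hnn : ∀ᵐ x ∂μ, 0 ≤ f x ⬝ᵥ ((absMat (B x) + (1 / 2 : ℝ) • B x) *ᵥ f x) :=
    hs.mono fun x hx => semiPos_absMat_add_half hx _
  refine ⟨integral_nonneg_of_ae hnn, fun h0 => ?_⟩
  have h1 := (integral_eq_zero_iff_of_nonneg_ae hnn (hf.integrable_dotProduct
    (hf.mulVec ((hB.absMat hs).add (hB.smul (1 / 2)))))).1 h0
  filter_upwards [h1, hs, hnull] with x hx hsx hnx
  exact eq_zero_of_absMat_add_half hsx hnx hx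

end Local

/-! ### The global forms, the energy identity and its consequences -/

section Global

variable {d m : ℕ} {Ω : Set (E d)} {𝒯 ℰ : Type*}

/-- The hypotheses on the coefficients in the form in which the analysis on the mesh uses them. -/
structure MeshCoefficients (mesh : Mesh d Ω 𝒯 ℰ) (A : Fin d → E d → Mat m) (D G : E d → Mat m)
    (N : 𝒯 → E d → Mat m) (M : E d → Mat m) : Prop where
  trace : ∀ K, IsNormalTrace (mesh.elem K) A D (N K)
  elem_conc : ∀ K, CompactlyConcentrated (volume.restrict (mesh.elem K))
  frontier_conc : ∀ K, CompactlyConcentrated ((surf d).restrict (frontier (mesh.elem K)))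
  mortar_conc : ∀ e, CompactlyConcentrated (mesh.mMeas e)
  G_bdd : ∀ K, MatLinfty G (volume.restrict (mesh.elem K))
  A_bdd : ∀ K k, MatLinfty (A k) (volume.restrict (mesh.elem K))
  D_bdd : ∀ K, MatLinfty D (volume.restrict (mesh.elem K))
  N_bdd : ∀ e, ∀ K ∈ mesh.sides e, MatLinfty (N K) (mesh.mMeas e)
  M_bdd : ∀ e, (mesh.sides e).card = 1 → MatLinfty M (mesh.mMeas e)
  A_symm : ∀ K k, ∀ᵐ x ∂(volume.restrict (mesh.elem K)), A k x = (A k x)ᵀ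
  N_symm : ∀ e, ∀ K ∈ mesh.sides e, ∀ᵐ x ∂(mesh.mMeas e), (N K x).IsHermitian

variable {mesh : Mesh d Ω 𝒯 ℰ} {p : 𝒯 → ℕ} {A : Fin d → E d → Mat m} {D G : E d → Mat m}
  {N : 𝒯 → E d → Mat m} {M : E d → Mat m}

theorem OneFieldFriedrichs.meshCoefficients [Fintype ℰ] (hd : 0 < d) (hΩ : IsOpen Ω)
    (hA : OneFieldFriedrichs Ω A D G) (hN : ∀ K, IsNormalTrace (mesh.elem K) A D (N K))
    (hMbdd : ∀ e, (mesh.sides e).card = 1 → MatLinfty M (mesh.mMeas e)) :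
    MeshCoefficients mesh A D G N M := by
  have hle : ∀ K, volume.restrict (mesh.elem K) ≤ (volume : Measure (E d)).restrict Ω :=
    fun K => Measure.restrict_mono (mesh.elem_subset K) le_rfl
  have hfin := mesh.isFiniteMeasure_frontier hd
  have hNs : ∀ K, ∀ᵐ x ∂((surf d).restrict (frontier (mesh.elem K))), (N K x).IsHermitian :=
    fun K => have := hfin K
      (hN K).symm (fun k => ae_mono (hle K) (hA.symm k)) (ae_mono (hle K) (hA.symm_div hΩ))
  refine
    { trace := hN
      elem_conc := mesh.compactlyConcentrated_elem
      frontier_conc := fun K => ⟨hfin K, closure (mesh.elem K),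
        isCompact_closure_openSimplex (mesh.simplex K), ?_⟩
      mortar_conc := fun e => ?_
      G_bdd := fun K => hA.G_bdd.mono_measure (hle K)
      A_bdd := fun K k => (hA.A_bdd k).mono_measure (hle K)
      D_bdd := fun K => hA.D_bdd.mono_measure (hle K)
      N_bdd := fun e K hK => (hN K).bdd.mono_measure (mesh.mMeas_le hK)
      M_bdd := hMbdd
      A_symm := fun K k => ae_mono (hle K) (hA.symm k)
      N_symm := fun e K hK => ae_mono (mesh.mMeas_le hK) (hNs K) }
  · filter_upwards [ae_restrict_mem isClosed_frontier.measurableSet] with x hx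
    exact frontier_subset_closure hx
  · obtain ⟨K, hK⟩ := mesh.sides_nonempty e
    exact mesh.compactlyConcentrated_mMeas hd hK

open Classical in
/-- The form of the local equations. -/
noncomputable def localForm [Fintype 𝒯] [Fintype ℰ] (mesh : Mesh d Ω 𝒯 ℰ) (p : 𝒯 → ℕ) (A : Fin d → E d → Mat m)
    (D G : E d → Mat m) (N : 𝒯 → E d → Mat m)
    (W δ : VolSpace d p m × TraceSpace mesh p m) : ℝ :=
  (∑ K, ∫ x in mesh.elem K,
      polyVal (W.1 K) x ⬝ᵥ
        (D x *ᵥ polyVal (δ.1 K) x + ∑ k, A k x *ᵥ polyPd k (δ.1 K) x))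
    + (∑ K, ∫ x in mesh.elem K, ((G x)ᵀ *ᵥ polyVal (W.1 K) x) ⬝ᵥ polyVal (δ.1 K) x)
    + (∑ K, ∑ e with K ∈ mesh.sides e,
        ∫ x, adjFlux mesh p N W.1 W.2 K e x ⬝ᵥ polyVal (δ.1 K) x ∂(mesh.mMeas e))

/-- The form of the jump in the global equation. -/
noncomputable def jumpForm [Fintype ℰ] (mesh : Mesh d Ω 𝒯 ℰ) (p : 𝒯 → ℕ) (N : 𝒯 → E d → Mat m)
    (W δ : VolSpace d p m × TraceSpace mesh p m) : ℝ :=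
  ∑ e, ∫ x, (∑ K ∈ mesh.sides e, adjFlux mesh p N W.1 W.2 K e x) ⬝ᵥ
    traceVal (δ.2 e) x ∂(mesh.mMeas e)

/-- The form of the boundary term in the global equation. -/
noncomputable def boundaryForm [Fintype ℰ] (mesh : Mesh d Ω 𝒯 ℰ) (p : 𝒯 → ℕ) (N : 𝒯 → E d → Mat m)
    (M : E d → Mat m) (W δ : VolSpace d p m × TraceSpace mesh p m) : ℝ :=
  ∑ e with (mesh.sides e).card = 1, ∑ K ∈ mesh.sides e,
    ∫ x, ((1 / 2 : ℝ) • ((-(N K x) + M x)ᵀ *ᵥ traceVal (W.2 e) x)) ⬝ᵥ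
      traceVal (δ.2 e) x ∂(mesh.mMeas e)

namespace MeshCoefficients

theorem isBilin_localForm [Fintype 𝒯] [Fintype ℰ] (h : MeshCoefficients mesh A D G N M) :
    IsBilin (localForm mesh p A D G N) := by
  classical
  refine ((IsBilin.sum fun K _ => ?_).add (IsBilin.sum fun K _ => ?_)).add
    (IsBilin.sum fun K _ => IsBilin.sum fun e he => ?_)
  · exact (isL2Field_polyVal (p := p) (m := m) (h.elem_conc K) K).isBilin
      (((isL2Field_polyVal (p := p) (m := m) (h.elem_conc K) K).mulVec (h.D_bdd K)).add
        (IsL2Field.sum fun k _ =>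
          (isL2Field_polyPd (p := p) (m := m) (h.elem_conc K) K k).mulVec (h.A_bdd K k)))
  · exact ((isL2Field_polyVal (p := p) (m := m) (h.elem_conc K) K).mulVec
      (h.G_bdd K).transpose).isBilin (isL2Field_polyVal (p := p) (m := m) (h.elem_conc K) K)
  · have hK := (Finset.mem_filter.1 he).2
    exact (isL2Field_adjFlux (p := p) (h.mortar_conc e) (h.N_bdd e K hK)
      (h.N_symm e K hK)).isBilin (isL2Field_polyVal (p := p) (m := m) (h.mortar_conc e) K)

theorem isBilin_jumpForm [Fintype ℰ] (h : MeshCoefficients mesh A D G N M) :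
    IsBilin (jumpForm mesh p N) := by
  refine IsBilin.sum fun e _ => ?_
  exact (IsL2Field.sum fun K hK => isL2Field_adjFlux (p := p) (h.mortar_conc e)
    (h.N_bdd e K hK) (h.N_symm e K hK)).isBilin (isL2Field_traceVal (p := p) (m := m) e)

theorem isBilin_boundaryForm [Fintype ℰ] (h : MeshCoefficients mesh A D G N M) :
    IsBilin (boundaryForm mesh p N M) := by
  refine IsBilin.sum fun e he => IsBilin.sum fun K hK => ?_
  have hM := h.M_bdd e (Finset.mem_filter.1 he).2
  exact (((isL2Field_traceVal (p := p) (m := m) e).mulVec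
    ((h.N_bdd e K hK).neg.add hM).transpose).smul (1 / 2)).isBilin
      (isL2Field_traceVal (p := p) (m := m) e)

variable (W : VolSpace d p m × TraceSpace mesh p m)

/-- On one mortar the trace terms combine with the boundary term to a nonnegative quantity. -/
theorem mortar_nonneg (h : MeshCoefficients mesh A D G N M)
    (hcont : ∀ e, ∀ K ∈ mesh.sides e, ∀ K' ∈ mesh.sides e, K ≠ K' →
      ∀ᵐ x ∂(mesh.mMeas e), N K' x = -(N K x))
    (hM : ∀ e, (mesh.sides e).card = 1 → ∀ᵐ x ∂(mesh.mMeas e), SemiPos (M x)) (e : ℰ) :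
    0 ≤ (∑ K ∈ mesh.sides e, (1 / 2) * ∫ x, traceVal (W.2 e) x ⬝ᵥ
          (N K x *ᵥ traceVal (W.2 e) x) ∂(mesh.mMeas e)) +
        if (mesh.sides e).card = 1 then ∑ K ∈ mesh.sides e,
          ∫ x, ((1 / 2 : ℝ) • ((-(N K x) + M x)ᵀ *ᵥ traceVal (W.2 e) x)) ⬝ᵥ
            traceVal (W.2 e) x ∂(mesh.mMeas e) else 0 := by
  classical
  have ht := (isL2Field_traceVal (p := p) (m := m) e).vecL2 W
  rcases mesh.card_sides e with h1 | h2
  · rw [if_pos h1, ← Finset.sum_add_distrib]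
    refine Finset.sum_nonneg fun K hK => ?_
    simp only [boundary_dotProduct_identity]
    rw [integral_sub ((ht.integrable_dotProduct (ht.mulVec (h.M_bdd e h1))).const_mul _)
      ((ht.integrable_dotProduct (ht.mulVec (h.N_bdd e K hK))).const_mul _), integral_const_mul,
      integral_const_mul, add_sub_cancel]
    refine mul_nonneg (by norm_num) (integral_nonneg_of_ae ?_)
    filter_upwards [hM e h1] with x hx
    exact hx _
  · obtain ⟨K, K', hne, hs⟩ := Finset.card_eq_two.1 h2
    -- The trace ŵ is single-valued while the normal matrices are opposite, so the two sides cancel.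
    have h3 : ∫ x, traceVal (W.2 e) x ⬝ᵥ (N K' x *ᵥ traceVal (W.2 e) x) ∂(mesh.mMeas e) =
        -∫ x, traceVal (W.2 e) x ⬝ᵥ (N K x *ᵥ traceVal (W.2 e) x) ∂(mesh.mMeas e) := by
      rw [← integral_neg]
      refine integral_congr_ae ?_
      filter_upwards [hcont e K (by simp [hs]) K' (by simp [hs]) hne] with x hx
      rw [hx, Matrix.neg_mulVec, dotProduct_neg]
    rw [if_neg (by omega), hs, Finset.sum_pair hne, h3]
    linarith

/-- The energy identity. -/
theorem energy_eq [Fintype 𝒯] [Fintype ℰ] (h : MeshCoefficients mesh A D G N M) :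
    localForm mesh p A D G N W W - jumpForm mesh p N W W + boundaryForm mesh p N M W W =
      (1 / 2) * (∑ K, ∫ x in mesh.elem K,
        polyVal (W.1 K) x ⬝ᵥ ((G x + (G x)ᵀ + D x) *ᵥ polyVal (W.1 K) x)) +
      (∑ e, ∑ K ∈ mesh.sides e, ∫ x, (polyVal (W.1 K) x - traceVal (W.2 e) x) ⬝ᵥ
        ((absMat (N K x) + (1 / 2 : ℝ) • N K x) *ᵥ (polyVal (W.1 K) x - traceVal (W.2 e) x))
          ∂(mesh.mMeas e)) +
      ∑ e, ((∑ K ∈ mesh.sides e, (1 / 2) * ∫ x, traceVal (W.2 e) x ⬝ᵥ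
          (N K x *ᵥ traceVal (W.2 e) x) ∂(mesh.mMeas e)) +
        if (mesh.sides e).card = 1 then ∑ K ∈ mesh.sides e,
          ∫ x, ((1 / 2 : ℝ) • ((-(N K x) + M x)ᵀ *ᵥ traceVal (W.2 e) x)) ⬝ᵥ
            traceVal (W.2 e) x ∂(mesh.mMeas e) else 0) := by
  classical
  have hp : ∀ e K, VecL2 (polyVal (W.1 K)) (mesh.mMeas e) := fun e K =>
    (isL2Field_polyVal (p := p) (m := m) (h.mortar_conc e) K).vecL2 W
  have ht : ∀ e, VecL2 (traceVal (W.2 e)) (mesh.mMeas e) := fun e =>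
    (isL2Field_traceVal (p := p) (m := m) e).vecL2 W
  have hf : ∀ e, ∀ K ∈ mesh.sides e, VecL2 (adjFlux mesh p N W.1 W.2 K e) (mesh.mMeas e) :=
    fun e K hK => (isL2Field_adjFlux (p := p) (h.mortar_conc e) (h.N_bdd e K hK)
      (h.N_symm e K hK)).vecL2 W
  have hswap : ∀ f : 𝒯 → ℰ → ℝ, ∑ K, ∑ e with K ∈ mesh.sides e, f K e =
      ∑ e, ∑ K ∈ mesh.sides e, f K e := fun f =>
    Finset.sum_comm' (by simp)
  have hfront : ∀ K, ∫ x in frontier (mesh.elem K),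
      polyVal (W.1 K) x ⬝ᵥ (N K x *ᵥ polyVal (W.1 K) x) ∂(surf d) =
      ∑ e with K ∈ mesh.sides e, ∫ x, polyVal (W.1 K) x ⬝ᵥ (N K x *ᵥ polyVal (W.1 K) x)
        ∂(mesh.mMeas e) := by
    intro K
    rw [mesh.surf_restrict_frontier, integral_finsetSum_measure]
    intro e he
    exact (hp e K).integrable_dotProduct ((hp e K).mulVec (h.N_bdd e K (Finset.mem_filter.1 he).2))
  have hflux : ∀ e, ∀ K ∈ mesh.sides e,
      (∫ x, adjFlux mesh p N W.1 W.2 K e x ⬝ᵥ polyVal (W.1 K) x ∂(mesh.mMeas e)) -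
        (∫ x, adjFlux mesh p N W.1 W.2 K e x ⬝ᵥ traceVal (W.2 e) x ∂(mesh.mMeas e)) +
        (1 / 2) * ∫ x, polyVal (W.1 K) x ⬝ᵥ (N K x *ᵥ polyVal (W.1 K) x) ∂(mesh.mMeas e) =
      (1 / 2) * (∫ x, traceVal (W.2 e) x ⬝ᵥ (N K x *ᵥ traceVal (W.2 e) x) ∂(mesh.mMeas e)) +
        ∫ x, (polyVal (W.1 K) x - traceVal (W.2 e) x) ⬝ᵥ
        ((absMat (N K x) + (1 / 2 : ℝ) • N K x) *ᵥ (polyVal (W.1 K) x - traceVal (W.2 e) x))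
          ∂(mesh.mMeas e) := by
    intro e K hK
    have hNb := h.N_bdd e K hK
    have hu := (hp e K).sub (ht e)
    have i1 := (hf e K hK).integrable_dotProduct (hp e K)
    have i2 := (hf e K hK).integrable_dotProduct (ht e)
    have i3 := ((hp e K).integrable_dotProduct ((hp e K).mulVec hNb)).const_mul (1 / 2)
    have i4 := ((ht e).integrable_dotProduct ((ht e).mulVec hNb)).const_mul (1 / 2)
    have i5 := hu.integrable_dotProduct
      (hu.mulVec ((hNb.absMat (h.N_symm e K hK)).add (hNb.smul (1 / 2))))
    have i12 : Integrable (fun x => adjFlux mesh p N W.1 W.2 K e x ⬝ᵥ polyVal (W.1 K) x -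
        adjFlux mesh p N W.1 W.2 K e x ⬝ᵥ traceVal (W.2 e) x) (mesh.mMeas e) := i1.sub i2
    rw [← integral_sub i1 i2, ← integral_const_mul, ← integral_const_mul,
      ← integral_add i12 i3, ← integral_add i4 i5]
    refine integral_congr_ae ?_
    filter_upwards [h.N_symm e K hK] with x hx
    exact flux_dotProduct_identity hx _ _
  have hjump : jumpForm mesh p N W W = ∑ e, ∑ K ∈ mesh.sides e,
      ∫ x, adjFlux mesh p N W.1 W.2 K e x ⬝ᵥ traceVal (W.2 e) x ∂(mesh.mMeas e) := by
    refine Finset.sum_congr rfl fun e _ => ?_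
    simp only [sum_dotProduct]
    exact integral_finsetSum _ fun K hK => (hf e K hK).integrable_dotProduct (ht e)
  have hloc : localForm mesh p A D G N W W =
      (1 / 2) * (∑ K, ∫ x in mesh.elem K,
        polyVal (W.1 K) x ⬝ᵥ ((G x + (G x)ᵀ + D x) *ᵥ polyVal (W.1 K) x)) +
      ∑ e, ∑ K ∈ mesh.sides e,
        ((1 / 2) * (∫ x, polyVal (W.1 K) x ⬝ᵥ (N K x *ᵥ polyVal (W.1 K) x) ∂(mesh.mMeas e)) +
        ∫ x, adjFlux mesh p N W.1 W.2 K e x ⬝ᵥ polyVal (W.1 K) x ∂(mesh.mMeas e)) := by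
    rw [localForm, ← Finset.sum_add_distrib, Finset.sum_congr rfl fun K _ =>
      (h.trace K).local_energy (h.elem_conc K) (h.frontier_conc K) (h.G_bdd K) (h.A_bdd K)
        (h.D_bdd K) (h.A_symm K) (W.1 K)]
    simp only [hfront, Finset.mul_sum, Finset.sum_add_distrib, hswap]
    ring
  -- Integration by parts puts half the form of A in w on each mortar side, exactly the term that
  -- the completed square absorbs.
  have hsum := Finset.sum_congr rfl fun e (_ : e ∈ Finset.univ) =>
    Finset.sum_congr rfl fun K hK => hflux e K hK
  simp only [Finset.sum_add_distrib, Finset.sum_sub_distrib] at hsum hloc ⊢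
  rw [hloc, hjump, boundaryForm, Finset.sum_filter]
  linarith

/-- Three nonnegative parts with sum zero vanish separately. The volume part kills w; the mortar
part then kills ŵ. -/
theorem eq_zero_of_energy [Fintype 𝒯] [Fintype ℰ] (h : MeshCoefficients mesh A D G N M)
    {μ₀ : ℝ} (hμ₀ : 0 < μ₀) (hcoer : ∀ᵐ x ∂(volume.restrict Ω),
      SemiPos (G x + (G x)ᵀ + D x - (2 * μ₀) • (1 : Mat m)))
    (hcont : ∀ e, ∀ K ∈ mesh.sides e, ∀ K' ∈ mesh.sides e, K ≠ K' →
      ∀ᵐ x ∂(mesh.mMeas e), N K' x = -(N K x))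
    (hnull : ∀ e, ∀ K ∈ mesh.sides e, ∀ᵐ x ∂(mesh.mMeas e),
      ∀ v : Fin m → ℝ, N K x *ᵥ v = 0 → v = 0)
    (hM : ∀ e, (mesh.sides e).card = 1 → ∀ᵐ x ∂(mesh.mMeas e), SemiPos (M x))
    (h0 : localForm mesh p A D G N W W - jumpForm mesh p N W W + boundaryForm mesh p N M W W = 0) :
    W = 0 := by
  rw [h.energy_eq W] at h0
  have hvol : ∀ K, _ ∧ _ := fun K => ae_eq_zero_of_integral_coercive
    ((isL2Field_polyVal (p := p) (m := m) (h.elem_conc K) K).vecL2 W)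
    (((h.G_bdd K).add (h.G_bdd K).transpose).add (h.D_bdd K)) (mul_pos two_pos hμ₀)
    (ae_mono (Measure.restrict_mono (mesh.elem_subset K) le_rfl) hcoer)
  have hmor : ∀ e, ∀ K ∈ mesh.sides e, _ ∧ _ := fun e K hK => ae_eq_zero_of_integral_absMat
    (((isL2Field_polyVal (p := p) (m := m) (h.mortar_conc e) K).vecL2 W).sub
      ((isL2Field_traceVal (p := p) (m := m) e).vecL2 W)) (h.N_bdd e K hK) (h.N_symm e K hK)
    (hnull e K hK)
  have n1 := Finset.sum_nonneg fun K (_ : K ∈ Finset.univ) => (hvol K).1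
  have n2 := Finset.sum_nonneg fun e (_ : e ∈ Finset.univ) =>
    Finset.sum_nonneg fun K hK => (hmor e K hK).1
  have n3 := Finset.sum_nonneg fun e (_ : e ∈ Finset.univ) => h.mortar_nonneg W hcont hM e
  have z1 := (Finset.sum_eq_zero_iff_of_nonneg fun K _ => (hvol K).1).1
    (le_antisymm (by linarith) n1)
  have z2 := (Finset.sum_eq_zero_iff_of_nonneg fun e _ =>
    Finset.sum_nonneg fun K hK => (hmor e K hK).1).1 (le_antisymm (by linarith) n2)
  have hw : W.1 = 0 := by
    funext K i
    have hK := (hvol K).2 (z1 K (Finset.mem_univ K))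
    refine Subtype.ext (eq_zero_of_ae_evalE_eq_zero (mesh.isOpen_elem K)
      (openSimplex_nonempty (mesh.simplex K)) ?_)
    filter_upwards [hK] with x hx
    exact congrFun hx i
  -- Every mortar has at least one side; there w - ŵ = 0 almost everywhere, and w is already zero.
  have hwh : W.2 = 0 := by
    funext e i
    obtain ⟨K, hK⟩ := mesh.sides_nonempty e
    have hz := (hmor e K hK).2 ((Finset.sum_eq_zero_iff_of_nonneg fun K hK =>
      (hmor e K hK).1).1 (z2 e (Finset.mem_univ e)) K hK)
    refine Subtype.ext (Lp.ext ?_)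
    filter_upwards [hz, Lp.coeFn_zero ℝ 2 (mesh.mMeas e)] with x hx hx0
    have h1 := congrFun hx i
    have h2 : polyVal (W.1 K) x i = 0 := by simp [polyVal, hw]
    rw [Pi.sub_apply, h2, zero_sub, Pi.zero_apply, neg_eq_zero] at h1
    exact h1.trans hx0.symm
  exact Prod.ext hw hwh

end MeshCoefficients

/-- Each equation sees only one component of the test pair. Letting both range over pairs places the
forms on one product space, where they can be combined. -/
theorem isAdjointSolution_iff [Fintype 𝒯] [Fintype ℰ]
    {dJ : VolSpace d p m × TraceSpace mesh p m →ₗ[ℝ] ℝ}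
    {W : VolSpace d p m × TraceSpace mesh p m} :
    IsAdjointSolution mesh p A D G N M dJ W ↔
      (∀ δ, localForm mesh p A D G N W δ = -dJ (δ.1, 0)) ∧
        ∀ δ, jumpForm mesh p N W δ = boundaryForm mesh p N M W δ + dJ (0, δ.2) :=
  ⟨fun h => ⟨fun δ => h.local_eq δ.1, fun δ => h.global_eq δ.2⟩,
    fun h => ⟨fun δz => h.1 (δz, 0), fun δzh => h.2 (0, δzh)⟩⟩

end Global

end HDG

/-! ### Unique solvability of the adjoint problem -/

theorem mainTheorem11 {d m : ℕ} (hd : 0 < d)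
    {Ω : Set (HDG.E d)} (hΩ : IsOpen Ω)
    {𝒯 ℰ : Type*} [Fintype 𝒯] [Fintype ℰ] (mesh : HDG.Mesh d Ω 𝒯 ℰ) (p : 𝒯 → ℕ)
    -- the Friedrichs' system
    (A : Fin d → HDG.E d → HDG.Mat m) (D G : HDG.E d → HDG.Mat m)
    (hA : HDG.OneFieldFriedrichs Ω A D G)
    -- the normal matrix `A = ∑ₖ nₖ Aₖ` on the boundary of each element
    (N : 𝒯 → HDG.E d → HDG.Mat m)
    (hN : ∀ K, HDG.IsNormalTrace (mesh.elem K) A D (N K))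
    -- it is single-valued across the skeleton, up to the orientation of the normal
    (hcont : ∀ e, ∀ K ∈ mesh.sides e, ∀ K' ∈ mesh.sides e, K ≠ K' →
      ∀ᵐ x ∂(mesh.mMeas e), N K' x = -(N K x))
    -- it has a trivial null space on the skeleton
    (hnull : ∀ e, ∀ K ∈ mesh.sides e, ∀ᵐ x ∂(mesh.mMeas e),
      ∀ v : Fin m → ℝ, N K x *ᵥ v = 0 → v = 0)
    -- the boundary operator `M ≥ 0`
    (M : HDG.E d → HDG.Mat m)
    (hMbdd : ∀ e, (mesh.sides e).card = 1 → HDG.MatLinfty M (mesh.mMeas e))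
    (hM : ∀ e, (mesh.sides e).card = 1 → ∀ᵐ x ∂(mesh.mMeas e), HDG.SemiPos (M x))
    -- the output functional `J` and its first variation at the primal state `Z`
    (J : HDG.VolSpace d p m × HDG.TraceSpace mesh p m → ℝ)
    (Z : HDG.VolSpace d p m × HDG.TraceSpace mesh p m)
    (dJ : HDG.VolSpace d p m × HDG.TraceSpace mesh p m →ₗ[ℝ] ℝ)
    (hJ : ∀ δ, HasLineDerivAt ℝ J (dJ δ) Z δ) :
    ∃! W : HDG.VolSpace d p m × HDG.TraceSpace mesh p m,
      HDG.IsAdjointSolution mesh p A D G N M dJ W := by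
  have h : HDG.MeshCoefficients mesh A D G N M := hA.meshCoefficients hd hΩ hN hMbdd
  obtain ⟨μ₀, hμ₀, hcoer⟩ := hA.coercive
  obtain ⟨Φ₁, hΦ₁⟩ := h.isBilin_localForm (p := p)
  obtain ⟨Φ₂, hΦ₂⟩ := (h.isBilin_jumpForm (p := p)).sub (h.isBilin_boundaryForm (p := p))
  have hiff : ∀ W, HDG.IsAdjointSolution mesh p A D G N M dJ W ↔ (Φ₁ - Φ₂) W = -dJ := by
    intro W
    rw [HDG.isAdjointSolution_iff]
    -- The jump and boundary forms depend on the trace component only, so their value at `(δz, 0)`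
    -- is their value at 0. With `htr`, this recovers the two equations from the combined one.
    have hvol : ∀ δz, Φ₂ W (δz, 0) = 0 := fun δz =>
      (hΦ₂ W (δz, 0)).trans ((hΦ₂ W 0).symm.trans (map_zero _))
    have htr : ∀ δzh, Φ₁ W (0, δzh) = 0 := fun δzh =>
      (hΦ₁ W (0, δzh)).trans ((hΦ₁ W 0).symm.trans (map_zero _))
    constructor
    · rintro ⟨h₁, h₂⟩
      refine LinearMap.ext fun δ => ?_
      have hδ : dJ δ = dJ (δ.1, 0) + dJ (0, δ.2) := by
        rw [← map_add]
        simp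
      have h₁δ := h₁ δ
      have h₂δ := h₂ δ
      rw [LinearMap.sub_apply, LinearMap.sub_apply, LinearMap.neg_apply, hΦ₁, hΦ₂, hδ]
      linarith
    · refine fun hΦ => ⟨fun δ => ?_, fun δ => ?_⟩
      · have := LinearMap.congr_fun hΦ (δ.1, 0)
        rw [LinearMap.sub_apply, LinearMap.sub_apply, LinearMap.neg_apply, hvol, sub_zero,
          hΦ₁] at this
        exact this
      · have := LinearMap.congr_fun hΦ (0, δ.2)
        rw [LinearMap.sub_apply, LinearMap.sub_apply, LinearMap.neg_apply, htr, zero_sub,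
          neg_inj, hΦ₂] at this
        exact sub_eq_iff_eq_add'.1 this
  have hinj : Function.Injective (Φ₁ - Φ₂) := by
    rw [← LinearMap.ker_eq_bot, LinearMap.ker_eq_bot']
    intro W hW
    refine h.eq_zero_of_energy W hμ₀ hcoer hcont hnull hM ?_
    have := LinearMap.congr_fun hW W
    rw [LinearMap.sub_apply, LinearMap.sub_apply, LinearMap.zero_apply, hΦ₁, hΦ₂] at this
    linarith
  -- A finite-dimensional space and its dual have equal dimension, so injectivity gives
  -- surjectivity.
  have hsurj : Function.Surjective (Φ₁ - Φ₂) :=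
    (LinearMap.injective_iff_surjective_of_finrank_eq_finrank
      (Subspace.dual_finrank_eq (K := ℝ)).symm).1 hinj
  obtain ⟨W, hW⟩ := hsurj (-dJ)
  exact ⟨W, (hiff W).2 hW, fun W' hW' => hinj (((hiff W').1 hW').trans hW.symm)⟩
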